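/- Let $D$ be a diagram of a link in $\mathbb{RP}^3$: finitely many generically immersed arcs and closed curves in the disc $D^2$, with over/under information at each double point (crossing), such that the end points of the arcs lie on $\partial D^2$, form antipodal pairs, and are the only points on $\partial D^2$. The net of $D$ is the projective plane obtained from $D^2$ by identifying antipodal points of $\partial D^2$; the image of $\partial D^2$ is the line at infinity. The regions of $D$ are the connected components of the complement of the curves in the net. $D$ is checkerboard colourable if its regions can be coloured black and white so that no two regions meeting along an arc have the same colour. Given such a colouring, splice each crossing so that the two resulting arcs follow the corners of the black regions, and put on these two arcs two arrows carrying the name of the crossing and its sign ($-$ for an $A$-splicing, $+$ for a $B$-splicing), both directed along the boundary of the small disc between the two arcs. The closed curves obtained in the net, with these arrows, present a signed ribbon graph: its vertices are discs bounded by the curves, and its edges are discs, one for each crossing, glued along the two arrows with that label. The ribbon graphs obtained in this way from the checkerboard colourings are the Tait graphs of $D$. A ribbon graph is plane if it is connected, orientable and of genus $0$ (a sphere with holes), and it is an $\mathbb{RP}^2$ ribbon graph if it is connected, non-orientable and of genus $1$ (a projective plane with holes). Suppose that $D$ is checkerboard colourable and that the union of its curves in the net is nonempty and connected. Then every Tait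 graph of $D$ is either a plane or an $\mathbb{RP}^2$ ribbon graph. More precisely, the Tait graphs are plane if every closed curve contained in the union of the curves of the net (possibly changing strands at crossings) is trivial in $H_1(\mathbb{RP}^2;\mathbb{Z}_2)$, and they are $\mathbb{RP}^2$ ribbon graphs otherwise. In particular, they are $\mathbb{RP}^2$ ribbon graphs if $D$ is not null-homologous, i.e. if some link component of $D$ gives a curve that is non-trivial in $H_1(\mathbb{RP}^2;\mathbb{Z}_2)$. -/

import Mathlib

/-! ## Signed arrow presentations and the surfaces of ribbon graphs -/

/-- The classes of the equivalence relation generated by `r`. -/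
abbrev Classes {α : Type} (r : α → α → Prop) : Type := Quotient (Relation.EqvGen.setoid r)

/-- The relation `r` joins any two elements of the nonempty type `α` by a finite chain. -/
def IsChainConnected {α : Type} (r : α → α → Prop) : Prop :=
  Nonempty α ∧ ∀ x y, Relation.EqvGen r x y

/-- The two ways of splicing a crossing. -/
inductive Splice
  | A
  | B

/-- The signs of the edges of a signed ribbon graph. -/
inductive EdgeSign
  | plus
  | minus

/-- A signed arrow presentation: finitely many closed curves carrying disjoint labelled, signed
arrows, every label occurring on exactly two arrows.

The curves are cut into segments at finitely many points; some of the points are thickened to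
marking arrows, the others carry no information (so curves without arrows are allowed).
`End` is the set of ends of segments, `seg` exchanges the two ends of a segment, `turn`
exchanges the two ends of segments that meet at a point or at an arrow.
`tail h` says that `h` sits at the tail of an arrow (whose head is then at `turn h`). The arrows are
thus the ends `h` with `tail h`, and `mate h` is the other arrow with the same label as `h`
(the value of `mate` and `sign` at other ends is irrelevant). -/
structure ArrowPresentation where
  End : Type
  [fin : Finite End]
  seg : End → End
  seg_seg : ∀ h, seg (seg h) = h
  seg_ne : ∀ h, seg h ≠ h
  turn : End → End
  turn_turn : ∀ h, turn (turn h) = h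
  turn_ne : ∀ h, turn h ≠ h
  tail : End → Prop
  tail_turn : ∀ h, tail h → ¬ tail (turn h)
  mate : End → End
  tail_mate : ∀ h, tail h → tail (mate h)
  mate_mate : ∀ h, tail h → mate (mate h) = h
  mate_ne : ∀ h, tail h → mate h ≠ h
  sign : End → EdgeSign
  sign_mate : ∀ h, tail h → sign (mate h) = sign h

attribute [instance] ArrowPresentation.fin

namespace ArrowPresentation

variable (G : ArrowPresentation)

/-- The vertices of the ribbon graph are discs bounded by the closed curves. -/
abbrev Vertex : Type := Classes fun x y : G.End => y = G.seg x ∨ y = G.turn x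

/-- The edges of the ribbon graph are the labels, that is, the pairs of arrows with equal labels. -/
abbrev Edge : Type := Classes fun x y : {h : G.End // G.tail h} => y.1 = G.mate x.1

open Classical in
/-- The disc of an edge has its boundary glued along the two arrows, both directed along the
boundary of this disc. So each of the two free sides of the edge leads from the head of one of
the arrows to the tail of the other. `side h` is the end reached from `h` along the
free side of an edge; at a point without an arrow one just continues along the curve. -/
noncomputable def side (h : G.End) : G.End :=
  if G.tail h then G.turn (G.mate h)
  else if G.tail (G.turn h) then G.mate (G.turn h)
  else G.turn h

/-- The boundary components of the ribbon graph, viewed as a surface: they run alternately along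
segments of the curves and free sides of edges. -/
abbrev BoundaryComponent : Type := Classes fun x y : G.End => y = G.seg x ∨ y = G.side x

/-- The Euler characteristic of the closed surface in which the ribbon graph is cellularly
embedded; this surface arises by gluing a disc to each boundary component. -/
noncomputable def eulerChar : ℤ :=
  (Nat.card G.Vertex : ℤ) - Nat.card G.Edge + Nat.card G.BoundaryComponent

/-- The ribbon graph is a nonempty connected surface. -/
def Connected : Prop :=
  IsChainConnected fun x y : G.End => y = G.seg x ∨ y = G.turn x ∨ y = G.side x

/-- The ribbon graph is an orientable surface: its vertex discs can be oriented coherently.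
Here `o h` tells whether, along the oriented boundary of its vertex disc, a segment is left at its
end `h`. The orientations extend over an edge iff the two arrows of the edge
either both agree or both disagree with the boundary orientation of the vertex discs. -/
def Orientable : Prop :=
  ∃ o : G.End → Bool, (∀ h, o (G.seg h) = !(o h)) ∧ (∀ h, o (G.turn h) = !(o h)) ∧
    ∀ h, G.tail h → o (G.mate h) = o h

/-- The genus of a connected ribbon graph is `g`: the Euler characteristic of the closed surface is
`2 - 2g` in the orientable and `2 - g` in the nonorientable case. -/
def HasGenus (g : ℕ) : Prop :=
  (G.Orientable ∧ G.eulerChar = 2 - 2 * (g : ℤ)) ∨ (¬ G.Orientable ∧ G.eulerChar = 2 - (g : ℤ))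

/-- A plane ribbon graph: a sphere with holes, i.e. connected, orientable and of genus zero. -/
def IsPlane : Prop := G.Connected ∧ G.Orientable ∧ G.HasGenus 0

/-- A projective plane with holes: connected, nonorientable and of genus one. -/
def IsRP2 : Prop := G.Connected ∧ ¬ G.Orientable ∧ G.HasGenus 1

end ArrowPresentation

/-! ## Discs with a cell decomposition -/

/-- A cell decomposition of the disc `D²` in the plane whose boundary circle is divided
antipodally, up to homeomorphism, as a rotation system.

Darts are oriented edges. `rot d` is the next dart counterclockwise around the initial point of `d`,
and `rev d` is the reversed dart; points and edges are the cycles of `rot` and `rev`.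
The cycles of `d ↦ rot⁻¹ (rev d)` are the complementary faces in the sphere, the face of `d`
being on the left of `d`. The decomposition is connected and has the Euler characteristic of the
sphere. The darts `bd i` form, counterclockwise, the circle `∂D²`, with the
disc on their left and the exterior face on their right; the antipode of
`bd i` is `bd (i + m)`. -/
structure CellDisc where
  Dart : Type
  [fin : Finite Dart]
  rot : Equiv.Perm Dart
  rev : Equiv.Perm Dart
  rev_rev : ∀ d, rev (rev d) = d
  rev_ne : ∀ d, rev d ≠ d
  connected : IsChainConnected fun d e : Dart => e = rot d ∨ e = rev d
  euler : Nat.card (Quotient (Equiv.Perm.SameCycle.setoid rot)) +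
      Nat.card (Quotient (Equiv.Perm.SameCycle.setoid (rot⁻¹ * rev))) =
    Nat.card (Quotient (Equiv.Perm.SameCycle.setoid rev)) + 2
  /-- half the number of edges of the boundary circle -/
  m : ℕ
  m_pos : 0 < m
  bd : ZMod (2 * m) → Dart
  /-- between `bd (i + 1)` and the preceding boundary edge lies only the exterior -/
  rot_rev_bd : ∀ i, rot (rev (bd i)) = bd (i + 1)
  /-- the boundary is a simple closed curve -/
  bd_simple : ∀ i j, rot.SameCycle (bd i) (bd j) → i = j
  rev_bd_ne : ∀ i j, rev (bd i) ≠ bd j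

attribute [instance] CellDisc.fin

namespace CellDisc

variable (C : CellDisc)

/-- The dart `d` starts at the initial point of the boundary edge `bd i`. -/
def AtBd (i : ZMod (2 * C.m)) (d : C.Dart) : Prop := C.rot.SameCycle (C.bd i) d

/-- The darts `d` and `e` start at antipodal points of `∂D²`. -/
def Antipodal (d e : C.Dart) : Prop := ∃ i, C.AtBd i d ∧ C.AtBd (i + C.m) e

/-- The initial points of `d` and `e` agree in the projective plane that arises from the disc by
identifying antipodal points of `∂D²`. -/
def SamePoint (d e : C.Dart) : Prop := C.rot.SameCycle d e ∨ C.Antipodal d e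

/-- Given the set `arc` of darts on the arcs of a diagram, `d` is one of the four darts that start
at a crossing. A crossing is an interior point of the disc with four darts, all of them on arcs. -/
def IsCrossing (arc : C.Dart → Prop) (d : C.Dart) : Prop :=
  (∀ i, ¬ C.AtBd i d) ∧ (∀ e, C.rot.SameCycle d e → arc e) ∧
    (C.rot ^ 4) d = d ∧ (C.rot ^ 2) d ≠ d

end CellDisc

/-! ## Diagrams of links in the projective space -/

/-- A diagram of a link in `ℝP³`: generically immersed arcs in the disc `D²`, whose end points lie on
`∂D²` and are divided into antipodal pairs, with over/under information at the double points.

The diagram is given by a cell decomposition of the disc whose `1`-skeleton contains the arcs: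
`arc d` says that `d` runs along an arc. Every system of arcs is contained in the `1`-skeleton of some
cell decomposition, in which the auxiliary edges (those not on arcs) avoid the crossings. The arcs need
not be connected, and an arc may be a closed curve without crossings.
The strands at a crossing are formed by opposite darts, `d` and `rot (rot d)`; `upper d` says that the
strand of `d` is the upper one (`upper` has no meaning away from crossings). -/
structure LinkDiagram extends CellDisc where
  arc : Dart → Prop
  arc_rev : ∀ d, arc d → arc (rev d)
  /-- arcs do not run along the boundary of the disc -/
  not_arc_bd : ∀ i, ¬ arc (bd i)
  /-- at most one end of an arc lies at a point of the boundary -/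
  end_unique : ∀ i d e, arc d → arc e → toCellDisc.AtBd i d → toCellDisc.AtBd i e → d = e
  /-- Away from the crossings the curves are simple: in the interior of the disc exactly two darts of the
  arcs meet, and each end of an arc on the boundary has an antipodal end of an arc. -/
  generic : ∀ d, arc d → toCellDisc.IsCrossing arc d ∨
    ∃! e, arc e ∧ e ≠ d ∧ toCellDisc.SamePoint d e
  upper : Dart → Prop
  upper_rot : ∀ d, toCellDisc.IsCrossing arc d → (upper (rot d) ↔ ¬ upper d)

namespace LinkDiagram

variable (D : LinkDiagram)

/-- The darts on the arcs of the diagram. -/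
abbrev ArcDart : Type := {d : D.Dart // D.arc d}

/-- The dart `d` starts at a crossing. -/
def AtCrossing (d : D.Dart) : Prop := D.IsCrossing D.arc d

/-- The crossings of the diagram. -/
abbrev Crossing : Type :=
  Quotient ((Equiv.Perm.SameCycle.setoid D.rot).comap
    (Subtype.val : {d : D.Dart // D.AtCrossing d} → D.Dart))

/-! ### The curves of the net -/

/-- The union of the curves of the net is a nonempty connected subset of the projective plane. -/
def Connected : Prop :=
  IsChainConnected fun d e : D.ArcDart => e.1 = D.rev d.1 ∨ D.SamePoint d.1 e.1

open Classical in
/-- Away from the crossings: the dart along which the curve of the net that comes in along `d`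
(against its direction) continues. -/
noncomputable def cont (d : D.ArcDart) : D.ArcDart :=
  if h : ∃ e : D.ArcDart, e ≠ d ∧ D.SamePoint d.1 e.1 then h.choose else d

theorem AtCrossing.rot {D : LinkDiagram} {d : D.Dart} (h : D.AtCrossing d) :
    D.AtCrossing (D.rot d) := by
  obtain ⟨h1, h2, h3, h4⟩ := h
  refine ⟨fun i hi => h1 i ?_, fun e he => h2 e ?_, ?_, ?_⟩
  · exact (Equiv.Perm.sameCycle_apply_right.1 hi)
  · exact (Equiv.Perm.sameCycle_apply_left.1 he)
  · rw [← Equiv.Perm.mul_apply, ← pow_succ, pow_succ', Equiv.Perm.mul_apply, h3]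
  · rw [← Equiv.Perm.mul_apply, ← pow_succ, pow_succ', Equiv.Perm.mul_apply]
    exact fun h => h4 (D.rot.injective h)

theorem AtCrossing.rot_inv {D : LinkDiagram} {d : D.Dart} (h : D.AtCrossing d) :
    D.AtCrossing (D.rot⁻¹ d) := by
  have : D.rot⁻¹ d = D.rot (D.rot (D.rot d)) := by
    rw [Equiv.Perm.inv_eq_iff_eq]; exact h.2.2.1.symm
  rw [this]
  exact h.rot.rot.rot

theorem AtCrossing.arc {D : LinkDiagram} {d : D.Dart} (h : D.AtCrossing d) : D.arc d :=
  h.2.1 d (Equiv.Perm.SameCycle.refl _ _)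

open Classical in
/-- The dart along which the curve of the net that comes in along `d` (against its
direction) continues: straight ahead at a crossing, and through the antipodal point at `∂D²`. -/
noncomputable def thru (d : D.ArcDart) : D.ArcDart :=
  if h : D.AtCrossing d.1 then ⟨D.rot (D.rot d.1), h.rot.rot.arc⟩ else D.cont d

/-- The next dart when one travels along a curve of the net. -/
noncomputable def step (d : D.ArcDart) : D.ArcDart := D.thru ⟨D.rev d.1, D.arc_rev _ d.2⟩

/-- The component of the diagram through `d` is null-homologous in `H₁(ℝP²) = ℤ₂`: the
corresponding closed curve of the net crosses the line at infinity an even number of times. -/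
def ComponentNull (d : D.ArcDart) : Prop :=
  Even (Nat.card {e : D.ArcDart // (∃ n : ℕ, D.step^[n] d = e) ∧ ∃ i, D.AtBd i e.1})

/-- A diagram is null-homologous if each of its components is. -/
def NullHomologous : Prop := ∀ d : D.ArcDart, D.ComponentNull d

/-- `D.Path d e p`: in the union of the curves of the net, there is a path from the initial point
of `d` to that of `e` that crosses the line at infinity `p` times modulo `2`. -/
inductive Path : D.ArcDart → D.ArcDart → ZMod 2 → Prop
  | refl (d : D.ArcDart) : Path d d 0
  | edge (d e f : D.ArcDart) (p : ZMod 2) : Path d e p → f.1 = D.rev e.1 → Path d f p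
  | turn (d e f : D.ArcDart) (p : ZMod 2) : Path d e p → D.rot.SameCycle e.1 f.1 → Path d f p
  | infinity (d e f : D.ArcDart) (p : ZMod 2) : Path d e p → D.Antipodal e.1 f.1 → Path d f (p + 1)

/-- Every closed curve contained in the union of the curves of the net is
null-homologous in the projective plane (also one that changes strands at crossings). -/
def TotallyNullHomologous : Prop := ∀ d : D.ArcDart, ¬ D.Path d d 1

/-! ### Regions and checkerboard colourings -/

/-- The relation that generates the regions. The dart `d` stands for the area on its left; for the
reversed boundary edge `rev (bd i)` this is the area beyond the line at infinity. -/
inductive Contiguous : D.Dart → D.Dart → Prop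
  /-- consecutive darts on the boundary of a cell of the disc -/
  | cell (d : D.Dart) : (∀ i, d ≠ D.rev (D.bd i)) → Contiguous d (D.rot⁻¹ (D.rev d))
  /-- the two sides of an edge that is not on an arc -/
  | edge (d : D.Dart) : ¬ D.arc d → Contiguous d (D.rev d)
  /-- antipodal boundary edges are identified in the net -/
  | infinity (i : ZMod (2 * D.m)) : Contiguous (D.bd i) (D.bd (i + D.m))

/-- The regions of the diagram: the collections of faces that form a single face of the net. -/
abbrev Region : Type := Classes D.Contiguous

/-- The region on the left of a dart. -/
def region (d : D.Dart) : D.Region := Quotient.mk _ d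

/-- A checkerboard colouring: no two regions that meet a common arc have the same colour.
The regions of colour `true` are black, the others are white. -/
def IsCheckerboardColouring (c : D.Region → Bool) : Prop :=
  ∀ d, D.arc d → c (D.region d) ≠ c (D.region (D.rev d))

/-- The diagram is checkerboard colourable. -/
def CheckerboardColourable : Prop := ∃ c, D.IsCheckerboardColouring c

/-! ### States and Tait graphs -/

/-- A state is a choice of an `A`- or `B`-splicing at each crossing. -/
abbrev State : Type := D.Crossing → Splice

variable {D}

/-- The splicing of the state `σ` at the crossing from which `d` starts joins `d` to `rot d`.
The `A`-splicing merges the corners of the crossing that the upper strand sweeps out when it is turned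
counterclockwise, so it joins `d` to `rot d` if `d` is on the lower strand. -/
def Joins (σ : D.State) (d : D.Dart) : Prop :=
  ∃ h : D.AtCrossing d, (D.upper d ↔ σ (Quotient.mk _ ⟨d, h⟩) = Splice.B)

theorem mk_rot (d : D.Dart) (h : D.AtCrossing d) (h2 : D.AtCrossing (D.rot d)) :
    (Quotient.mk _ ⟨D.rot d, h2⟩ : D.Crossing) = Quotient.mk _ ⟨d, h⟩ :=
  Quotient.sound (Equiv.Perm.sameCycle_apply_left.2 (Equiv.Perm.SameCycle.refl _ _))

theorem joins_rot (σ : D.State) (d : D.Dart) (h : D.AtCrossing d) :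
    Joins σ (D.rot d) ↔ ¬ Joins σ d := by
  have e := mk_rot d h h.rot
  have o := D.upper_rot d h
  constructor
  · rintro ⟨_, h1⟩ ⟨_, h2⟩
    rw [e] at h1
    tauto
  · intro hn
    refine ⟨h.rot, ?_⟩
    rw [e]
    by_contra hc
    exact hn ⟨h, by tauto⟩

open Classical in
/-- In the spliced diagram, the dart along which the curve coming in along `d` (against its direction)
continues. -/
noncomputable def spliced (σ : D.State) (d : D.ArcDart) : D.ArcDart :=
  if h : D.AtCrossing d.1 then
    if Joins σ d.1 then ⟨D.rot d.1, h.rot.arc⟩ else ⟨D.rot⁻¹ d.1, h.rot_inv.arc⟩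
  else D.cont d

open Classical in
/-- The opposite dart at a crossing. -/
noncomputable def opposite (d : D.ArcDart) : D.ArcDart :=
  if h : D.AtCrossing d.1 then ⟨D.rot (D.rot d.1), h.rot.rot.arc⟩ else d

open Classical in
/-- The sign of a marked splicing: `-` for an `A`-splicing and `+` for a `B`-splicing. -/
noncomputable def spliceSign (σ : D.State) (d : D.ArcDart) : EdgeSign :=
  if h : D.AtCrossing d.1 then
    match σ (Quotient.mk _ ⟨d.1, h⟩) with
    | Splice.A => EdgeSign.minus
    | Splice.B => EdgeSign.plus
  else EdgeSign.plus

theorem SamePoint_symm {d e : D.Dart} (h : D.SamePoint d e) : D.SamePoint e d := by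
  rcases h with h | ⟨i, h1, h2⟩
  · exact Or.inl h.symm
  · refine Or.inr ⟨i + D.m, h2, ?_⟩
    have : (i + D.m + D.m : ZMod (2 * D.m)) = i := by
      have h0 : ((2 * D.m : ℕ) : ZMod (2 * D.m)) = 0 := ZMod.natCast_self _
      push_cast at h0
      rw [add_assoc, ← two_mul, h0, add_zero]
    rw [this]
    exact h1

theorem not_atCrossing_of_samePoint {d e : D.Dart} (h : ¬ D.AtCrossing d) (hs : D.SamePoint d e) :
    ¬ D.AtCrossing e := by
  intro he
  rcases hs with hs | ⟨i, _, h2⟩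
  · apply h
    obtain ⟨n, rfl⟩ := hs.exists_nat_pow_eq.imp fun n hn => hn.symm
    clear hs
    induction n with
    | zero => simpa using he
    | succ n ih =>
      apply ih
      have := he.rot_inv
      rw [pow_succ', Equiv.Perm.mul_apply] at this
      rwa [show D.rot⁻¹ (D.rot ((D.rot ^ n) d)) = (D.rot ^ n) d from
        D.rot.symm_apply_apply _] at this
  · exact he.1 _ h2

theorem exists_cont (d : D.ArcDart) (h : ¬ D.AtCrossing d.1) :
    ∃ e : D.ArcDart, e ≠ d ∧ D.SamePoint d.1 e.1 := by
  obtain ⟨e, ⟨he, hne, hs⟩, _⟩ := (D.generic d.1 d.2).resolve_left h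
  exact ⟨⟨e, he⟩, fun hh => hne (congrArg Subtype.val hh), hs⟩

theorem cont_spec (d : D.ArcDart) (h : ¬ D.AtCrossing d.1) :
    D.cont d ≠ d ∧ D.SamePoint d.1 (D.cont d).1 := by
  have hx := exists_cont d h
  rw [cont, dif_pos hx]
  exact hx.choose_spec

theorem cont_cont (d : D.ArcDart) (h : ¬ D.AtCrossing d.1) : D.cont (D.cont d) = d := by
  obtain ⟨h1, h2⟩ := cont_spec d h
  have h' := not_atCrossing_of_samePoint h h2
  obtain ⟨h3, h4⟩ := cont_spec (D.cont d) h'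
  have hu := ((D.generic _ (D.cont d).2).resolve_left h').unique
    ⟨(D.cont (D.cont d)).2, fun hh => h3 (Subtype.ext hh), h4⟩
    ⟨d.2, fun hh => h1 (Subtype.ext hh.symm), SamePoint_symm h2⟩
  exact Subtype.ext hu

theorem spliced_spliced (σ : D.State) (d : D.ArcDart) : spliced σ (spliced σ d) = d := by
  by_cases h : D.AtCrossing d.1
  · by_cases hj : Joins σ d.1
    · have e1 : spliced σ d = ⟨D.rot d.1, h.rot.arc⟩ := by
        rw [spliced, dif_pos h, if_pos hj]
      rw [e1, spliced, dif_pos h.rot, if_neg (by rw [joins_rot σ _ h]; exact not_not.2 hj)]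
      exact Subtype.ext (D.rot.symm_apply_apply _)
    · have e1 : spliced σ d = ⟨D.rot⁻¹ d.1, h.rot_inv.arc⟩ := by
        rw [spliced, dif_pos h, if_neg hj]
      have hj2 : Joins σ (D.rot⁻¹ d.1) := by
        have := joins_rot σ _ h.rot_inv
        rw [show D.rot (D.rot⁻¹ d.1) = d.1 from D.rot.apply_symm_apply _] at this
        tauto
      rw [e1, spliced, dif_pos h.rot_inv, if_pos hj2]
      exact Subtype.ext (D.rot.apply_symm_apply _)
  · have e1 : spliced σ d = D.cont d := by rw [spliced, dif_neg h]
    rw [e1, spliced, dif_neg (not_atCrossing_of_samePoint h (cont_spec d h).2), cont_cont d h]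

theorem AtCrossing.rot_ne {d : D.Dart} (h : D.AtCrossing d) : D.rot d ≠ d := by
  intro hh
  apply h.2.2.2
  rw [pow_two, Equiv.Perm.mul_apply, hh, hh]

theorem spliced_ne (σ : D.State) (d : D.ArcDart) : spliced σ d ≠ d := by
  by_cases h : D.AtCrossing d.1
  · rw [spliced, dif_pos h]
    split_ifs
    · exact fun hh => h.rot_ne (congrArg Subtype.val hh)
    · intro hh
      have := congrArg Subtype.val hh
      rw [Equiv.Perm.inv_eq_iff_eq] at this
      exact h.rot_ne this.symm
  · rw [spliced, dif_neg h]
    exact (cont_spec d h).1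

/-- The signed arrow presentation of a state of a diagram, i.e. the signed ribbon graph `G_(D,σ)`.
Its curves are those of the net after splicing. At a crossing that is
replaced by two arcs, from `d` to `rot d` and from `rot (rot d)` to the remaining dart, these arcs carry
arrows with the same label, directed in this way; so they both are
directed along the boundary of the disc between the two arcs. -/
noncomputable def ribbonGraph (σ : D.State) : ArrowPresentation :=
  { End := D.ArcDart
    seg := fun d => ⟨D.rev d.1, D.arc_rev _ d.2⟩
    seg_seg := fun d => Subtype.ext (D.rev_rev d.1)
    seg_ne := fun d hd => D.rev_ne d.1 (congrArg Subtype.val hd)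
    turn := spliced σ
    turn_turn := spliced_spliced σ
    turn_ne := spliced_ne σ
    tail := fun d => Joins σ d.1
    tail_turn := by
      rintro d hj
      have h : D.AtCrossing d.1 := hj.1
      rw [spliced, dif_pos h, if_pos hj, joins_rot σ _ h]
      exact not_not.2 hj
    mate := opposite
    tail_mate := by
      rintro d hj
      have h : D.AtCrossing d.1 := hj.1
      rw [opposite, dif_pos h, joins_rot σ _ h.rot, joins_rot σ _ h]
      exact not_not.2 hj
    mate_mate := by
      rintro d hj
      have h : D.AtCrossing d.1 := hj.1
      have e1 : opposite d = ⟨D.rot (D.rot d.1), h.rot.rot.arc⟩ := by rw [opposite, dif_pos h]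
      rw [e1, opposite, dif_pos h.rot.rot]
      exact Subtype.ext h.2.2.1
    mate_ne := by
      rintro d hj hh
      have h : D.AtCrossing d.1 := hj.1
      rw [opposite, dif_pos h] at hh
      exact h.2.2.2 (congrArg Subtype.val hh)
    sign := spliceSign σ
    sign_mate := by
      rintro d hj
      have h : D.AtCrossing d.1 := hj.1
      have e1 : opposite d = ⟨D.rot (D.rot d.1), h.rot.rot.arc⟩ := by rw [opposite, dif_pos h]
      rw [e1, spliceSign, spliceSign, dif_pos h.rot.rot, dif_pos h, mk_rot _ h.rot h.rot.rot,
        mk_rot _ h h.rot] }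

open Classical in
/-- The state that follows the black regions of a checkerboard colouring `c`: at each crossing,
the two arcs of the splicing run along the corners of the black regions, so that `d` is joined to
`rot d` if the corner between them is black. That is the `B`-splicing if the corners that follow the darts
of the upper strand counterclockwise are black, and otherwise the `A`-splicing. -/
noncomputable def taitState (c : D.Region → Bool) : D.State := fun v =>
  if ∃ d : {d : D.Dart // D.AtCrossing d},
      (Quotient.mk _ d : D.Crossing) = v ∧ D.upper d.1 ∧ c (D.region d.1) = true
  then Splice.B else Splice.A

variable (D)

/-- `G` is a Tait graph of `D`: the signed ribbon graph of the state that follows the black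
regions of some checkerboard colouring. -/
def IsTaitGraph (G : ArrowPresentation) : Prop :=
  ∃ c, D.IsCheckerboardColouring c ∧ G = ribbonGraph (taitState c)

end LinkDiagram

/-! Let Σ be the closed surface obtained from the Tait graph by capping its boundary components. The
vertex discs are bounded by the curves of the black splicing. The free sides of the edges follow the
complementary splicing (`side_ribbonGraph`), so the caps are bounded by the white curves. Shrinking
each ribbon edge to its crossing, Σ becomes the union of the curves of the net with a disc glued to
every black and every white curve. With P points and E crossings there are P + E arcs, so its Euler
characteristic χ is V - E + B. As H²(Σ; 𝔽₂) = 𝔽₂, the space Z of 1-cocycles has dimension P + 1 - χ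
(`finrank_cocycles_sideDiff`, `card_arcDart_eq`).

The space Z can also be computed in the net. A cocycle of Σ has primitives along the boundary curves
of the regions, so it extends over the regions to a cocycle of the projective plane. On the disc
this is the coboundary of a function, which jumps by a constant between antipodal points
(`cocycles_le`). Conversely, a black or white curve keeps its colour on one side, hence is two-sided
and crosses the line at infinity an even number of times, so coboundaries of functions with a jump
are cocycles of Σ (`le_cocycles`). These functions form a space of dimension P + 1. The kernel of
the coboundary on it consists of the constants, with one more dimension exactly if there is a
potential: a function that is constant along arcs and jumps by 1 at infinity. Hence χ is 2 if a
potential exists and 1 otherwise.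

Adding the colour turns a potential into an orientation of Σ and vice versa
(`orientable_ribbonGraph_iff`). A potential exists iff counting crossings of the line at infinity
modulo 2 is path independent, which is `TotallyNullHomologous` (`totallyNullHomologous_iff`). -/

/-! ## Counting over the field with two elements -/

section LinearAlgebra

/-- The functions to `𝔽₂` that are constant on the classes generated by `r`. -/
def invariantFns {X : Type} (r : X → X → Prop) : Submodule (ZMod 2) (X → ZMod 2) where
  carrier := {f | ∀ x y, r x y → f x = f y}
  add_mem' := by
    intro f g hf hg x y h
    simp only [Pi.add_apply, hf x y h, hg x y h]
  zero_mem' := fun _ _ _ => rfl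
  smul_mem' := by
    intro a f hf x y h
    simp only [Pi.smul_apply, hf x y h]

theorem mem_invariantFns {X : Type} {r : X → X → Prop} {f : X → ZMod 2} :
    f ∈ invariantFns r ↔ ∀ x y, r x y → f x = f y := Iff.rfl

theorem eq_of_eqvGen {X Y : Type} {r : X → X → Prop} {f : X → Y} (hf : ∀ x y, r x y → f x = f y)
    {x y : X} (h : Relation.EqvGen r x y) : f x = f y := by
  induction h with
  | rel x y h => exact hf x y h
  | refl x => rfl
  | symm x y _ ih => exact ih.symm
  | trans x y z _ _ ih1 ih2 => exact ih1.trans ih2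

/-- Turns the numbers of points, vertices, faces and boundary components into dimensions: the
invariant functions are the pullbacks along the quotient map. -/
theorem finrank_invariantFns {X : Type} [Finite X] (r : X → X → Prop) :
    Module.finrank (ZMod 2) (invariantFns r) = Nat.card (Classes r) := by
  classical
  have := Fintype.ofFinite (Classes r)
  have hinj : Function.Injective
      (LinearMap.funLeft (ZMod 2) (ZMod 2) (Quotient.mk (Relation.EqvGen.setoid r))) :=
    LinearMap.funLeft_injective_of_surjective _ _ _ Quotient.mk_surjective
  have hr : invariantFns r = LinearMap.range
      (LinearMap.funLeft (ZMod 2) (ZMod 2) (Quotient.mk (Relation.EqvGen.setoid r))) := by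
    ext f
    constructor
    · intro hf
      exact ⟨Quotient.lift f fun x y h => eq_of_eqvGen hf h, rfl⟩
    · rintro ⟨g, rfl⟩ x y h
      exact congrArg g (Quotient.sound (Relation.EqvGen.rel x y h))
  rw [hr, LinearMap.finrank_range_of_inj hinj, Module.finrank_fintype_fun_eq_card,
    Nat.card_eq_fintype_card]

variable {X : Type} {s : X → X}

theorem eqvGen_involution (hs : ∀ x, s (s x) = x) {x y : X} :
    Relation.EqvGen (fun x y => y = s x) x y ↔ y = x ∨ y = s x := by
  constructor
  · intro h
    induction h with
    | rel x y h => exact Or.inr h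
    | refl x => exact Or.inl rfl
    | symm x y _ ih => rcases ih with rfl | rfl <;> simp [hs]
    | trans x y z _ _ ih1 ih2 => rcases ih1 with rfl | rfl <;> rcases ih2 with rfl | rfl <;> simp [hs]
  · rintro (rfl | rfl)
    · exact Relation.EqvGen.refl _
    · exact Relation.EqvGen.rel _ _ rfl

theorem sum_involution_classes [Fintype X] (hs : ∀ x, s (s x) = x) (hne : ∀ x, s x ≠ x)
    [Fintype (Classes fun x y => y = s x)] {M : Type} [AddCommMonoid M] (g : X → M) :
    ∑ e : Classes (fun x y => y = s x), (g e.out + g (s e.out)) = ∑ x, g x := by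
  classical
  rw [← Finset.sum_fiberwise Finset.univ
    (fun x => (Quotient.mk _ x : Classes fun x y => y = s x)) g]
  refine Finset.sum_congr rfl fun e _ => ?_
  have : Finset.univ.filter (fun x => (Quotient.mk _ x : Classes fun x y => y = s x) = e) =
      {e.out, s e.out} := by
    ext x
    simp only [Finset.mem_filter, Finset.mem_univ, true_and, Finset.mem_insert,
      Finset.mem_singleton]
    conv_lhs => rw [← Quotient.out_eq e, eq_comm, Quotient.eq]
    exact eqvGen_involution hs
  rw [this, Finset.sum_pair (hne _).symm]

theorem card_eq_two_mul_classes [Finite X] (hs : ∀ x, s (s x) = x) (hne : ∀ x, s x ≠ x) :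
    Nat.card X = 2 * Nat.card (Classes fun x y => y = s x) := by
  classical
  have := Fintype.ofFinite X
  have := Fintype.ofFinite (Classes fun x y => y = s x)
  have h := sum_involution_classes hs hne (fun _ => (1 : ℕ))
  simp only [Finset.sum_const, smul_eq_mul, Finset.card_univ] at h
  rw [Nat.card_eq_fintype_card, Nat.card_eq_fintype_card]
  omega

/-- The coboundary of a function on the ends of edges, where `s` exchanges the two ends. -/
def coboundary (s : X → X) : (X → ZMod 2) →ₗ[ZMod 2] (X → ZMod 2) :=
  LinearMap.id + LinearMap.funLeft _ _ s

@[simp]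
theorem coboundary_apply (s : X → X) (f : X → ZMod 2) (x : X) :
    coboundary s f x = f x + f (s x) := rfl

/-- The cochains that have a primitive along every side of every edge. Here `δ` assigns to a
function on the corners its differences along the sides. -/
def cocycles {A : Type} [AddCommGroup A] [Module (ZMod 2) A] (s : X → X)
    (δ : A →ₗ[ZMod 2] (X → ZMod 2)) : Submodule (ZMod 2) (X → ZMod 2) :=
  (LinearMap.ker (coboundary s ∘ₗ δ)).map δ

theorem mem_cocycles {A : Type} [AddCommGroup A] [Module (ZMod 2) A]
    {δ : A →ₗ[ZMod 2] (X → ZMod 2)} {f : X → ZMod 2} :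
    f ∈ cocycles s δ ↔ (∃ a, δ a = f) ∧ ∀ x, f (s x) = f x := by
  have h2 : ∀ a b : ZMod 2, a + b = 0 ↔ b = a := by decide
  constructor
  · rintro ⟨a, ha, rfl⟩
    refine ⟨⟨a, rfl⟩, fun x => ?_⟩
    have := congrFun (LinearMap.mem_ker.1 ha) x
    exact (h2 _ _).1 this
  · rintro ⟨⟨a, rfl⟩, h⟩
    exact ⟨a, LinearMap.mem_ker.2 (funext fun x => (h2 _ _).2 (h x)), rfl⟩

/-- The sums of two unit vectors span the hyperplane of vectors with zero sum, so `R` is squeezed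
between the two. -/
theorem finrank_add_one_of_single_add_mem {ι : Type} [Fintype ι] [DecidableEq ι] [Nonempty ι]
    (R : Submodule (ZMod 2) (ι → ZMod 2)) (h0 : ∀ f ∈ R, ∑ i, f i = 0)
    (h1 : ∀ i j, (Pi.single i 1 + Pi.single j 1 : ι → ZMod 2) ∈ R) :
    Module.finrank (ZMod 2) R + 1 = Fintype.card ι := by
  let σ : (ι → ZMod 2) →ₗ[ZMod 2] ZMod 2 := ∑ i, LinearMap.proj i
  have hσ : ∀ f, σ f = ∑ i, f i := fun f => by simp [σ]
  have hR : R = LinearMap.ker σ := by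
    apply le_antisymm
    · intro f hf
      rw [LinearMap.mem_ker, hσ, h0 f hf]
    · intro f hf
      rw [LinearMap.mem_ker, hσ] at hf
      obtain ⟨j⟩ := ‹Nonempty ι›
      -- The terms at `j` add up to the coordinate sum of `f`, which vanishes.
      have : f = ∑ i, f i • (Pi.single i 1 + Pi.single j 1 : ι → ZMod 2) := by
        simp only [smul_add, Finset.sum_add_distrib, ← Finset.sum_smul, hf, zero_smul, add_zero]
        ext k
        simp [Finset.sum_apply, Pi.single_apply]
      rw [this]
      exact R.sum_mem fun i _ => R.smul_mem _ (h1 i j)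
  have hsurj : LinearMap.range σ = ⊤ := by
    rw [LinearMap.range_eq_top]
    intro a
    obtain ⟨j⟩ := ‹Nonempty ι›
    exact ⟨Pi.single j a, by simp [hσ]⟩
  have := LinearMap.finrank_range_add_finrank_ker σ
  rw [hsurj, ← hR, finrank_top, Module.finrank_self, Module.finrank_fintype_fun_eq_card] at this
  omega

/-- The number of independent cocycles of a connected closed surface that is cut into polygons. -/
theorem finrank_cocycles {A : Type} [AddCommGroup A] [Module (ZMod 2) A]
    [FiniteDimensional (ZMod 2) A] [Fintype X] [DecidableEq X]
    (hs : ∀ x, s (s x) = x) (hne : ∀ x, s x ≠ x)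
    (δ : A →ₗ[ZMod 2] (X → ZMod 2)) (h0 : ∀ a, ∑ x, δ a x = 0) {r : X → X → Prop}
    (hr : IsChainConnected r)
    (h1 : ∀ x y, r x y → ∃ a, coboundary s (δ a) =
      Pi.single x 1 + Pi.single (s x) 1 + (Pi.single y 1 + Pi.single (s y) 1))
    (hA : Module.finrank (ZMod 2) A = Nat.card X) :
    2 * Module.finrank (ZMod 2) (cocycles s δ) + 2 * Module.finrank (ZMod 2) (LinearMap.ker δ) =
      Nat.card X + 2 := by
  classical
  have := Fintype.ofFinite (Classes fun x y => y = s x)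
  have : Nonempty (Classes fun x y => y = s x) := hr.1.map (Quotient.mk _)
  -- `Ψ` records, once for each edge, the discrepancy between the differences seen from its two
  -- sides.
  let Ψ : A →ₗ[ZMod 2] (Classes (fun x y => y = s x) → ZMod 2) :=
    LinearMap.funLeft _ _ Quotient.out ∘ₗ coboundary s ∘ₗ δ
  have hΨ : ∀ a e, Ψ a e = δ a e.out + δ a (s e.out) := fun a e => rfl
  have hker : LinearMap.ker Ψ = LinearMap.ker (coboundary s ∘ₗ δ) := by
    ext a
    simp only [LinearMap.mem_ker]
    constructor
    · intro h
      funext x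
      have hx := congrFun h (Quotient.mk _ x)
      rw [hΨ] at hx
      have h3 : Relation.EqvGen (fun x y => y = s x)
          (Quotient.mk _ x : Classes fun x y => y = s x).out x :=
        Quotient.exact (Quotient.out_eq (Quotient.mk _ x : Classes fun x y => y = s x))
      rcases (eqvGen_involution hs).1 h3 with h4 | h4
      · rw [← h4] at hx; exact hx
      · rw [← h4] at hx
        have h5 := congrArg s h4
        rw [hs] at h5
        rw [← h5, add_comm] at hx
        exact hx
    · intro h
      funext e
      exact congrFun h e.out
  have hmem : ∀ x y, Relation.EqvGen r x y → (Pi.single x 1 + Pi.single (s x) 1 +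
      (Pi.single y 1 + Pi.single (s y) 1) : X → ZMod 2) ∈ LinearMap.range (coboundary s ∘ₗ δ) := by
    intro x y h
    induction h with
    | rel x y h =>
      obtain ⟨a, ha⟩ := h1 x y h
      exact ⟨a, ha⟩
    | refl x =>
      convert Submodule.zero_mem _ using 1
      exact funext fun z =>
        CharTwo.add_self_eq_zero ((Pi.single x 1 + Pi.single (s x) 1 : X → ZMod 2) z)
    | symm x y _ ih => rwa [add_comm]
    | trans x y z _ _ ih1 ih2 =>
      have h2 : ∀ a b c : ZMod 2, a + c = a + b + (b + c) := by decide
      convert Submodule.add_mem _ ih1 ih2 using 1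
      exact funext fun _ => h2 _ _ _
  -- This is H² = 𝔽₂: the discrepancies have sum zero, and by connectedness any two edges can be
  -- changed simultaneously, so the range is the whole hyperplane.
  have hrank : Module.finrank (ZMod 2) (LinearMap.range Ψ) + 1 =
      Fintype.card (Classes fun x y => y = s x) := by
    refine finrank_add_one_of_single_add_mem _ ?_ ?_
    · rintro _ ⟨a, rfl⟩
      simp only [hΨ]
      rw [sum_involution_classes hs hne, h0]
    · intro i j
      obtain ⟨a, ha⟩ := hmem i.out j.out (hr.2 _ _)
      refine ⟨a, ?_⟩
      have key : ∀ i e : Classes (fun x y => y = s x),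
          (Pi.single i.out 1 + Pi.single (s i.out) 1 : X → ZMod 2) e.out =
            (Pi.single i 1 : _ → ZMod 2) e := by
        intro i e
        by_cases h : e = i
        · subst h
          simp [(hne _).symm]
        · have h1 : e.out ≠ i.out := fun h' => h (by rw [← Quotient.out_eq e, h', Quotient.out_eq])
          have h2 : e.out ≠ s i.out := by
            intro h'
            apply h
            rw [← Quotient.out_eq e, ← Quotient.out_eq i]
            refine Quotient.sound ((eqvGen_involution hs).2 (Or.inr ?_))
            rw [h', hs]
          simp [h, h1, h2]
      funext e
      have := congrFun ha e.out
      rw [Pi.add_apply, ← key i e, ← key j e]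
      exact this
  have e1 := LinearMap.finrank_range_add_finrank_ker Ψ
  have e2 : Module.finrank (ZMod 2) (cocycles s δ) + Module.finrank (ZMod 2) (LinearMap.ker δ) =
      Module.finrank (ZMod 2) (LinearMap.ker Ψ) := by
    rw [hker]
    have h3 := LinearMap.finrank_range_add_finrank_ker
      (δ.domRestrict (LinearMap.ker (coboundary s ∘ₗ δ)))
    rw [LinearMap.range_domRestrict, LinearMap.ker_domRestrict] at h3
    have h4 : LinearMap.ker δ ≤ LinearMap.ker (coboundary s ∘ₗ δ) := LinearMap.ker_le_ker_comp _ _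
    rw [← h3, (Submodule.comapSubtypeEquivOfLe h4).finrank_eq]
    rfl
  have e3 := card_eq_two_mul_classes hs hne
  rw [Nat.card_eq_fintype_card (α := Classes _)] at e3
  omega

end LinearAlgebra

/-! ## Closed cochains of a cell decomposition of the sphere -/

theorem card_sameCycle_quotient {X : Type} [Finite X] (π : Equiv.Perm X) :
    Nat.card (Quotient (Equiv.Perm.SameCycle.setoid π)) = Nat.card (Classes fun x y => y = π x) := by
  refine Nat.card_congr (Quotient.congr (Equiv.refl X) fun x y => ?_)
  change π.SameCycle x y ↔ Relation.EqvGen (fun x y => y = π x) x y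
  constructor
  · intro h
    obtain ⟨n, rfl⟩ := h.exists_nat_pow_eq
    clear h
    induction n with
    | zero => exact Relation.EqvGen.refl _
    | succ n ih =>
      rw [pow_succ', Equiv.Perm.mul_apply]
      exact ih.trans _ _ _ (Relation.EqvGen.rel _ _ rfl)
  · intro h
    induction h with
    | rel x y h => subst h; exact Equiv.Perm.sameCycle_apply_right.2 (Equiv.Perm.SameCycle.refl _ _)
    | refl x => exact Equiv.Perm.SameCycle.refl _ _
    | symm x y _ ih => exact ih.symm
    | trans x y z _ _ ih1 ih2 => exact ih1.trans ih2

/-- A nonempty finite graph with `V` vertices has coboundary space of dimension `V - 1`, if it is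
connected. -/
theorem finrank_map_coboundary {X : Type} [Finite X] (s : X → X) {r : X → X → Prop}
    (h : IsChainConnected fun x y => y = s x ∨ r x y) :
    Module.finrank (ZMod 2) ((invariantFns r).map (coboundary s)) + 1 =
      Module.finrank (ZMod 2) (invariantFns r) := by
  have h3 := LinearMap.finrank_range_add_finrank_ker ((coboundary s).domRestrict (invariantFns r))
  rw [LinearMap.range_domRestrict] at h3
  rw [← h3]
  congr 1
  obtain ⟨x0⟩ := h.1
  have hone : (fun _ => 1 : X → ZMod 2) ∈ invariantFns r := fun _ _ _ => rfl
  symm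
  refine (finrank_eq_one_iff_of_nonzero' (⟨⟨_, hone⟩, ?_⟩ : LinearMap.ker
    ((coboundary s).domRestrict (invariantFns r))) ?_).2 ?_
  · exact LinearMap.mem_ker.2 (funext fun x => CharTwo.add_self_eq_zero _)
  · intro h0
    have := congrFun (congrArg (fun z => z.1.1) h0) x0
    exact one_ne_zero this
  · rintro ⟨⟨f, hf⟩, hf2⟩
    refine ⟨f x0, Subtype.ext (Subtype.ext (funext fun x => ?_))⟩
    have h2 : ∀ a b : ZMod 2, a + b = 0 → a = b := by decide
    have : f x0 = f x := by
      refine eq_of_eqvGen (r := fun x y => y = s x ∨ r x y) ?_ (h.2 x0 x)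
      rintro x y (rfl | hxy)
      · exact h2 _ _ (congrFun (LinearMap.mem_ker.1 hf2) x)
      · exact hf x y hxy
    change f x0 * 1 = f x
    rw [mul_one, this]

/-- This is H¹ = 0 for the sphere. `G` lives on the corners of the faces, and the hypothesis says
that its differences along the two sides of an edge agree. Coboundaries are cocycles, of dimension V
- 1 by connectedness; cocycles have dimension E + 1 - F by `finrank_cocycles`; Euler's formula makes
these equal. -/
theorem CellDisc.exists_primitive (C : CellDisc) (G : C.Dart → ZMod 2)
    (hG : ∀ d, G (C.rev d) + G (C.rot⁻¹ d) = G d + G (C.rot⁻¹ (C.rev d))) :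
    ∃ u : C.Dart → ZMod 2, (∀ d, u (C.rot d) = u d) ∧
      ∀ d, G d + G (C.rot⁻¹ (C.rev d)) = u d + u (C.rev d) := by
  classical
  have := Fintype.ofFinite C.Dart
  let φ : Equiv.Perm C.Dart := C.rot⁻¹ * C.rev
  have hφ : ∀ d, φ d = C.rot⁻¹ (C.rev d) := fun _ => rfl
  let vtx : C.Dart → C.Dart → Prop := fun d e => e = C.rot d
  have hc : IsChainConnected fun d e : C.Dart => e = C.rev d ∨ vtx d e := by
    simpa only [vtx, or_comm] using C.connected
  have h1 := finrank_cocycles C.rev_rev C.rev_ne (coboundary φ) (fun G => by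
      simp only [coboundary_apply, Finset.sum_add_distrib]
      rw [Equiv.sum_comp φ G]
      exact CharTwo.add_self_eq_zero _) C.connected (fun x y hxy => by
        rcases hxy with rfl | rfl
        -- Changing the value at the corner between `x` and `rot x` affects exactly the two edges at
        -- this corner.
        · refine ⟨Pi.single x 1, funext fun z => ?_⟩
          have e1 : φ z = x ↔ z = C.rev (C.rot x) := by
            rw [hφ, Equiv.Perm.inv_eq_iff_eq]
            exact ⟨fun h => by rw [← h, C.rev_rev], fun h => by rw [h, C.rev_rev]⟩
          have e2 : C.rev z = x ↔ z = C.rev x :=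
            ⟨fun h => by rw [← h, C.rev_rev], fun h => by rw [h, C.rev_rev]⟩
          have e3 : φ (C.rev z) = x ↔ z = C.rot x := by
            rw [hφ, C.rev_rev, Equiv.Perm.inv_eq_iff_eq]
          simp only [coboundary_apply, Pi.add_apply, Pi.single_apply, e1, e2, e3]
          ring
        · refine ⟨0, ?_⟩
          have h2 : ∀ a b : ZMod 2, 0 = a + b + (b + a) := by decide
          rw [C.rev_rev, map_zero, map_zero]
          exact funext fun _ => h2 _ _) (by
        rw [Module.finrank_fintype_fun_eq_card, Nat.card_eq_fintype_card])
  have h2 := finrank_map_coboundary (r := vtx) C.rev hc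
  have h3 : LinearMap.ker (coboundary φ) = invariantFns fun x y => y = φ x := by
    have h2 : ∀ a b : ZMod 2, a + b = 0 ↔ a = b := by decide
    ext f
    rw [LinearMap.mem_ker]
    constructor
    · rintro h x _ rfl
      exact (h2 _ _).1 (congrFun h x)
    · intro h
      exact funext fun x => (h2 _ _).2 (h x _ rfl)
  have h4 := card_eq_two_mul_classes C.rev_rev C.rev_ne
  have h5 := C.euler
  rw [card_sameCycle_quotient, card_sameCycle_quotient, card_sameCycle_quotient] at h5
  change Nat.card (Classes vtx) + Nat.card (Classes fun x y => y = φ x) = _ + 2 at h5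
  rw [h3, finrank_invariantFns] at h1
  rw [finrank_invariantFns] at h2
  have hle : (invariantFns vtx).map (coboundary C.rev) ≤ cocycles C.rev (coboundary φ) := by
    rintro _ ⟨u, hu, rfl⟩
    refine mem_cocycles.2 ⟨⟨u, funext fun d => ?_⟩, fun d => ?_⟩
    · have := hu (φ d) (C.rev d) (C.rot.apply_symm_apply _).symm
      simp only [coboundary_apply, this]
    · simp only [coboundary_apply, C.rev_rev, add_comm]
  have heq := Submodule.eq_of_le_of_finrank_eq hle (by omega)
  have hmem : coboundary φ G ∈ cocycles C.rev (coboundary φ) := by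
    refine mem_cocycles.2 ⟨⟨G, rfl⟩, fun d => ?_⟩
    simp only [coboundary_apply, hφ, C.rev_rev]
    exact hG d
  rw [← heq] at hmem
  obtain ⟨u, hu, h⟩ := hmem
  exact ⟨u, fun d => (hu d _ rfl).symm, fun d => (congrFun h d).symm⟩

/-! ## Orienting the curves formed by two matchings -/

/-- The orbits of two fixed point free involutions are even cycles or infinite paths, so they can be
coloured alternately. -/
theorem exists_alternating {X : Type} {s t : X → X} (hs : ∀ x, s (s x) = x) (hs' : ∀ x, s x ≠ x)
    (ht : ∀ x, t (t x) = x) (ht' : ∀ x, t x ≠ x) :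
    ∃ o : X → ZMod 2, (∀ x, o (s x) = o x + 1) ∧ ∀ x, o (t x) = o x + 1 := by
  classical
  let S : Equiv.Perm X := ⟨s, s, hs, hs⟩
  let T : Equiv.Perm X := ⟨t, t, ht, ht⟩
  have hSS : S * S = 1 := Equiv.ext hs
  have hTT : T * T = 1 := Equiv.ext ht
  have hSi : S⁻¹ = S := inv_eq_of_mul_eq_one_left hSS
  have hTi : T⁻¹ = T := inv_eq_of_mul_eq_one_left hTT
  let π : Equiv.Perm X := T * S
  have hconj : S * π * S⁻¹ = π⁻¹ := by
    simp only [π, mul_inv_rev, hSi, hTi, mul_assoc, hSS, mul_one]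
  have hpow : ∀ (n : ℤ) x, S ((π ^ n) x) = (π ^ (-n)) (S x) := by
    intro n x
    have h : S * π ^ n = π ^ (-n) * S := by
      rw [← mul_inv_eq_iff_eq_mul, ← conj_zpow, hconj, zpow_neg, inv_zpow]
    exact congrArg (fun f : Equiv.Perm X => f x) h
  have hadd : ∀ (a b : ℤ) x, (π ^ a) ((π ^ b) x) = (π ^ (a + b)) x := by
    intro a b x
    rw [zpow_add, Equiv.Perm.mul_apply]
  -- The maps `s` and `t` act as reflections of an orbit. If `s x` were `π ^ n x`, the midpoint of
  -- the chain would be fixed by `s` for even `n` and by `t` for odd `n`.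
  have hnot : ∀ x, ¬ π.SameCycle x (s x) := by
    rintro x ⟨n, hn⟩
    change (π ^ n) x = S x at hn
    rcases Int.even_or_odd' n with ⟨j, rfl | rfl⟩
    · apply hs' ((π ^ j) x)
      change S ((π ^ j) x) = _
      rw [hpow, ← hn, hadd]
      congr 2
      ring
    · apply ht' (s ((π ^ j) x))
      change π ((π ^ j) x) = S ((π ^ j) x)
      rw [hpow, ← hn, hadd, ← Equiv.Perm.mul_apply, ← zpow_one_add]
      congr 2
      ring
  have hsame : ∀ x y, π.SameCycle x y → π.SameCycle (s x) (s y) := by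
    rintro x _ ⟨n, rfl⟩
    exact ⟨-n, (hpow n x).symm⟩
  let Q := Quotient (Equiv.Perm.SameCycle.setoid π)
  let q : X → Q := Quotient.mk _
  let sq : Q → Q := Quotient.map s hsame
  have hsq : ∀ x, sq (q x) = q (s x) := fun _ => rfl
  have hq : ∀ x, q (s x) ≠ q x := fun x h => hnot x (Quotient.exact h).symm
  have hqt : ∀ x, q (t x) = q (s x) := by
    intro x
    refine Quotient.sound (Equiv.Perm.SameCycle.symm ⟨1, ?_⟩)
    change t (s (s x)) = t x
    rw [hs]
  -- Each orbit of the two involutions consists of two cycles of `π` exchanged by `s` and by `t`; an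
  -- arbitrary linear order singles out one of them.
  let _ : LinearOrder Q := linearOrderOfSTO WellOrderingRel
  let o : X → ZMod 2 := fun x => if q x < q (s x) then 1 else 0
  have ho : ∀ x, o (s x) = o x + 1 := by
    intro x
    simp only [o, hs]
    rcases lt_or_gt_of_ne (hq x) with h | h
    · rw [if_pos h, if_neg h.not_gt, zero_add]
    · rw [if_neg h.not_gt, if_pos h]; rfl
  refine ⟨o, ho, fun x => ?_⟩
  rw [← ho]
  have h2 : q (s (t x)) = q (s (s x)) := by
    have := hqt (t x)
    rw [ht] at this
    rw [← this, hs]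
  simp only [o]
  rw [h2, hqt]

namespace LinkDiagram

variable {D : LinkDiagram}

/-! ## The local structure of a diagram -/

theorem antipodal_symm {d e : D.Dart} (h : D.Antipodal d e) : D.Antipodal e d := by
  obtain ⟨i, h1, h2⟩ := h
  refine ⟨i + D.m, h2, ?_⟩
  have h0 : ((2 * D.m : ℕ) : ZMod (2 * D.m)) = 0 := ZMod.natCast_self _
  push_cast at h0
  rw [add_assoc, ← two_mul, h0, add_zero]
  exact h1

theorem not_atCrossing_of_atBd {i : ZMod (2 * D.m)} {d : D.Dart} (h : D.AtBd i d) :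
    ¬ D.AtCrossing d := fun hc => hc.1 i h

theorem eq_or_eq_cont {d e : D.ArcDart} (h : ¬ D.AtCrossing d.1) (hs : D.SamePoint d.1 e.1) :
    e = d ∨ e = D.cont d := by
  by_cases hne : e = d
  · exact Or.inl hne
  · obtain ⟨h1, h2⟩ := cont_spec d h
    exact Or.inr (Subtype.ext (((D.generic _ d.2).resolve_left h).unique
      ⟨e.2, fun hh => hne (Subtype.ext hh), hs⟩
      ⟨(D.cont d).2, fun hh => h1 (Subtype.ext hh), h2⟩))

/-- The corner from `d` counterclockwise to `rot d` lies in one cell; the hypothesis excludes the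
exterior corner at a boundary point. -/
theorem region_rev_rot {d : D.Dart} (h : ∀ i, D.rot d ≠ D.bd i) :
    D.region (D.rev (D.rot d)) = D.region d := by
  refine Quotient.sound (Relation.EqvGen.rel _ _ ?_)
  have := Contiguous.cell (D := D) (D.rev (D.rot d)) fun i hi => h i (D.rev.injective hi)
  rwa [D.rev_rev, show D.rot⁻¹ (D.rot d) = d from D.rot.symm_apply_apply d] at this

theorem region_rev {d : D.Dart} (h : ¬ D.arc d) : D.region (D.rev d) = D.region d :=
  (Quotient.sound (Relation.EqvGen.rel _ _ (Contiguous.edge d h))).symm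

theorem region_bd_antipode (i : ZMod (2 * D.m)) : D.region (D.bd (i + D.m)) = D.region (D.bd i) :=
  (Quotient.sound (Relation.EqvGen.rel _ _ (Contiguous.infinity i))).symm

theorem region_cell {d : D.Dart} (h : ∀ i, d ≠ D.rev (D.bd i)) :
    D.region (D.rot⁻¹ (D.rev d)) = D.region d :=
  (Quotient.sound (Relation.EqvGen.rel _ _ (Contiguous.cell d h))).symm

theorem region_rot {d : D.Dart} (h : ¬ D.arc (D.rot d)) (hb : ∀ i, D.rot d ≠ D.bd i) :
    D.region (D.rot d) = D.region d := by
  rw [← region_rev h, region_rev_rot hb]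

theorem arc_ne_bd {d : D.Dart} (h : D.arc d) (i : ZMod (2 * D.m)) : d ≠ D.bd i := by
  rintro rfl
  exact D.not_arc_bd i h

theorem colour_rot_ne {c : D.Region → Bool} (hc : D.IsCheckerboardColouring c) {d : D.Dart}
    (h : D.arc (D.rot d)) : c (D.region (D.rot d)) ≠ c (D.region d) := by
  rw [← region_rev_rot (d := d) fun i => arc_ne_bd h i]
  exact hc _ h

theorem region_rot_pow {d : D.Dart} (n : ℕ)
    (h : ∀ j, j < n → ¬ D.arc ((D.rot ^ (j + 1)) d) ∧ ∀ i, (D.rot ^ (j + 1)) d ≠ D.bd i) :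
    D.region ((D.rot ^ n) d) = D.region d := by
  induction n with
  | zero => rfl
  | succ n ih =>
    obtain ⟨h1, h2⟩ := h n n.lt_succ_self
    rw [← ih fun j hj => h j (hj.trans n.lt_succ_self)]
    rw [pow_succ', Equiv.Perm.mul_apply] at h1 h2 ⊢
    exact region_rot h1 h2

theorem sameCycle_rot_pow (d : D.Dart) (n : ℕ) : D.rot.SameCycle d ((D.rot ^ n) d) :=
  ⟨n, by rw [zpow_natCast]⟩

/-- Where a strand passes an interior point that is not a crossing, its two sides are seen
in opposite positions from the two darts. -/
theorem colour_ne_of_sameCycle {c : D.Region → Bool} (hc : D.IsCheckerboardColouring c)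
    {d e : D.ArcDart} (h : ¬ D.AtCrossing d.1) (hs : D.rot.SameCycle d.1 e.1) (hne : e ≠ d) :
    c (D.region e.1) ≠ c (D.region d.1) := by
  classical
  -- A boundary point carries only one end of an arc, so the point lies in the interior.
  have hbd : ∀ i, ¬ D.AtBd i d.1 := fun i hi =>
    hne (Subtype.ext (D.end_unique i _ _ e.2 d.2 (hi.trans hs) hi))
  have hex := hs.exists_nat_pow_eq
  obtain ⟨k, hk⟩ : ∃ k, Nat.find hex = k + 1 := by
    refine Nat.exists_eq_succ_of_ne_zero fun h0 => ?_
    have := Nat.find_spec hex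
    rw [h0] at this
    exact hne (Subtype.ext this.symm)
  have hspec := Nat.find_spec hex
  have hmin : ∀ j, j < k + 1 → (D.rot ^ j) d.1 ≠ e.1 := fun j hj => Nat.find_min hex (hk ▸ hj)
  rw [hk] at hspec
  have h2 : D.region ((D.rot ^ k) d.1) = D.region d.1 := by
    -- Before `e` is reached the rotation meets no arc: the only other arc dart at this point is
    -- `d`, and a return to `d` would make `e` appear earlier.
    refine region_rot_pow k fun j hj => ⟨fun ha => ?_, fun i hi => hbd i ?_⟩
    · have hsp : D.SamePoint d.1 ((D.rot ^ (j + 1)) d.1) := Or.inl (sameCycle_rot_pow _ _)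
      have hx : ((⟨_, ha⟩ : D.ArcDart) = e) ∨ ((⟨_, ha⟩ : D.ArcDart) = d) := by
        have h3 := (eq_or_eq_cont h (Or.inl hs)).resolve_left hne
        rcases eq_or_eq_cont (e := ⟨_, ha⟩) h hsp with h4 | h4
        · exact Or.inr h4
        · exact Or.inl (h4.trans h3.symm)
      rcases hx with h3 | h3
      · exact hmin (j + 1) (by omega) (congrArg Subtype.val h3)
      · have h4 : (D.rot ^ (j + 1)) d.1 = d.1 := congrArg Subtype.val h3
        apply hmin (k - j) (by omega)
        rw [← hspec, show k + 1 = k - j + (j + 1) by omega, pow_add _ (k - j), Equiv.Perm.mul_apply, h4]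
    · rw [CellDisc.AtBd, ← hi]
      exact (sameCycle_rot_pow _ _).symm
  rw [← h2, ← hspec, pow_succ', Equiv.Perm.mul_apply]
  apply colour_rot_ne hc
  rw [← Equiv.Perm.mul_apply, ← pow_succ', hspec]
  exact e.2

theorem rot_rev_bd_pred (i : ZMod (2 * D.m)) : D.rot (D.rev (D.bd (i - 1))) = D.bd i := by
  rw [D.rot_rev_bd, sub_add_cancel]

/-- Turning counterclockwise from `d`, only auxiliary edges are met before the last edge in front of
the exterior, which is `rev (bd (i - 1))`. -/
theorem region_of_atBd {i : ZMod (2 * D.m)} {d : D.Dart} (hd : D.arc d) (h : D.AtBd i d) :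
    D.region d = D.region (D.bd (i - 1)) := by
  classical
  have hs : D.rot.SameCycle d (D.rev (D.bd (i - 1))) := by
    rw [← Equiv.Perm.sameCycle_apply_right, rot_rev_bd_pred]
    exact h.symm
  have hex := hs.exists_nat_pow_eq
  have hspec := Nat.find_spec hex
  have hmin : ∀ j, j < Nat.find hex → (D.rot ^ j) d ≠ D.rev (D.bd (i - 1)) :=
    fun j hj => Nat.find_min hex hj
  generalize Nat.find hex = k at hspec hmin
  rw [← region_rev (D.not_arc_bd _), ← hspec]
  refine (region_rot_pow k fun j hj => ⟨fun ha => ?_, fun i' hi => ?_⟩).symm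
  · have h4 : (D.rot ^ (j + 1)) d = d :=
      D.end_unique i _ _ ha hd (h.trans (sameCycle_rot_pow _ _)) h
    apply hmin (k - (j + 1)) (by omega)
    rw [← hspec]
    conv_rhs => rw [show k = k - (j + 1) + (j + 1) by omega, pow_add, Equiv.Perm.mul_apply, h4]
  · have h5 : i = i' := by
      apply D.bd_simple
      rw [← hi]
      exact h.trans (sameCycle_rot_pow _ _)
    subst h5
    rw [pow_succ', Equiv.Perm.mul_apply, ← rot_rev_bd_pred] at hi
    exact hmin j hj (D.rot.injective hi)

/-- At the line at infinity, the antipodal map reverses the orientation of the disc. -/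
theorem region_eq_of_antipodal {d e : D.ArcDart} (h : D.Antipodal d.1 e.1) :
    D.region e.1 = D.region d.1 := by
  obtain ⟨i, h1, h2⟩ := h
  rw [region_of_atBd d.2 h1, region_of_atBd e.2 h2, ← region_bd_antipode (i - 1)]
  congr 2
  ring

/-! ## States and their complements -/

/-- The state with the other splicing at each crossing. -/
def dualState (σ : D.State) : D.State := fun v =>
  match σ v with
  | Splice.A => Splice.B
  | Splice.B => Splice.A

theorem joins_dualState (σ : D.State) {d : D.Dart} (h : D.AtCrossing d) :
    Joins (dualState σ) d ↔ ¬ Joins σ d := by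
  have key : dualState σ (Quotient.mk _ ⟨d, h⟩) = Splice.B ↔
      ¬ σ (Quotient.mk _ ⟨d, h⟩) = Splice.B := by
    unfold dualState
    cases σ (Quotient.mk _ ⟨d, h⟩) <;> simp
  constructor
  · rintro ⟨_, h1⟩ ⟨_, h2⟩
    rw [key] at h1
    tauto
  · intro hn
    refine ⟨h, ?_⟩
    rw [key]
    by_contra hc
    exact hn ⟨h, by tauto⟩

/-- Reversing a dart of the arcs. -/
def revArc (d : D.ArcDart) : D.ArcDart := ⟨D.rev d.1, D.arc_rev _ d.2⟩

theorem revArc_revArc (d : D.ArcDart) : revArc (revArc d) = d := Subtype.ext (D.rev_rev d.1)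

theorem revArc_ne (d : D.ArcDart) : revArc d ≠ d := fun h => D.rev_ne d.1 (congrArg Subtype.val h)

theorem spliced_of_joins {σ : D.State} {d : D.ArcDart} (h : Joins σ d.1) :
    (spliced σ d).1 = D.rot d.1 := by
  rw [spliced, dif_pos h.1, if_pos h]

theorem spliced_of_not_joins {σ : D.State} {d : D.ArcDart} (hd : D.AtCrossing d.1)
    (h : ¬ Joins σ d.1) : (spliced σ d).1 = D.rot⁻¹ d.1 := by
  rw [spliced, dif_pos hd, if_neg h]

theorem spliced_of_not_atCrossing {σ : D.State} {d : D.ArcDart} (hd : ¬ D.AtCrossing d.1) :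
    spliced σ d = D.cont d := by
  rw [spliced, dif_neg hd]

-- The free sides of a ribbon edge replace the two arcs of a splicing by the two arcs of the other
-- one. So the boundary components are the curves of the dual state.
open Classical in
theorem side_ribbonGraph (σ : D.State) (d : D.ArcDart) :
    (ribbonGraph σ).side d = spliced (dualState σ) d := by
  have hopp : ∀ d : D.ArcDart, D.AtCrossing d.1 → (opposite d).1 = D.rot (D.rot d.1) := by
    intro d h
    rw [opposite, dif_pos h]
  have hside : (ribbonGraph σ).side d = if Joins σ d.1 then spliced σ (opposite d)
      else if Joins σ (spliced σ d).1 then opposite (spliced σ d) else spliced σ d := rfl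
  rw [hside]
  by_cases h : D.AtCrossing d.1
  · by_cases hj : Joins σ d.1
    · rw [if_pos hj]
      apply Subtype.ext
      have h1 : Joins σ (opposite d).1 := by
        rw [hopp d h, joins_rot σ _ h.rot, joins_rot σ _ h]
        exact not_not.2 hj
      rw [spliced_of_joins h1, hopp d h, spliced_of_not_joins h
        (by rw [joins_dualState σ h]; exact not_not.2 hj), eq_comm, Equiv.Perm.inv_eq_iff_eq]
      exact h.2.2.1.symm
    · have e1 := spliced_of_not_joins h hj
      have h2 : Joins σ (spliced σ d).1 := by
        have := joins_rot σ _ h.rot_inv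
        rw [show D.rot (D.rot⁻¹ d.1) = d.1 from D.rot.apply_symm_apply _] at this
        rw [e1]
        tauto
      rw [if_neg hj, if_pos h2]
      apply Subtype.ext
      rw [hopp _ h2.1, e1, spliced_of_joins ((joins_dualState σ h).2 hj)]
      exact congrArg D.rot (D.rot.apply_symm_apply _)
  · have h1 : ¬ Joins σ d.1 := fun hj => h hj.1
    have h2 : ¬ D.AtCrossing (D.cont d).1 := not_atCrossing_of_samePoint h (cont_spec d h).2
    rw [if_neg h1, spliced_of_not_atCrossing h, if_neg fun hj => h2 hj.1,
      spliced_of_not_atCrossing h]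

theorem samePoint_spliced (σ : D.State) (d : D.ArcDart) : D.SamePoint d.1 (spliced σ d).1 := by
  by_cases h : D.AtCrossing d.1
  · left
    by_cases hj : Joins σ d.1
    · rw [spliced_of_joins hj]
      exact Equiv.Perm.sameCycle_apply_right.2 (Equiv.Perm.SameCycle.refl _ _)
    · rw [spliced_of_not_joins h hj]
      exact ⟨-1, by rw [zpow_neg_one]⟩
  · rw [spliced_of_not_atCrossing h]
    exact (cont_spec d h).2

/-- Inside the disc, the two darts leaving a point of a spliced curve see the curve from opposite
sides. The hypothesis excludes passing the line at infinity, where the colour is kept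
(`region_eq_of_antipodal`). -/
theorem colour_spliced_ne {c : D.Region → Bool} (hc : D.IsCheckerboardColouring c) (σ : D.State)
    {d : D.ArcDart} (hs : D.rot.SameCycle d.1 (spliced σ d).1) :
    c (D.region (spliced σ d).1) ≠ c (D.region d.1) := by
  by_cases h : D.AtCrossing d.1
  · by_cases hj : Joins σ d.1
    · rw [spliced_of_joins hj]
      exact colour_rot_ne hc h.rot.arc
    · rw [spliced_of_not_joins h hj]
      have e : D.rot (D.rot⁻¹ d.1) = d.1 := D.rot.apply_symm_apply _
      have := colour_rot_ne hc (d := D.rot⁻¹ d.1) (by rw [e]; exact d.2)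
      rw [e] at this
      exact this.symm
  · exact colour_ne_of_sameCycle hc h hs (spliced_ne σ d)

/-- Any two darts of the arcs at a point of the net are related by splicings. -/
theorem eqvGen_of_samePoint (σ : D.State) {d e : D.ArcDart} (h : D.SamePoint d.1 e.1) :
    Relation.EqvGen (fun x y => y = spliced σ x ∨ y = spliced (dualState σ) x) d e := by
  by_cases hd : D.AtCrossing d.1
  · rcases h with h | ⟨i, h, _⟩
    · obtain ⟨n, hn⟩ := h.exists_nat_pow_eq
      clear h
      induction n generalizing e with
      | zero =>
        rw [show e = d from Subtype.ext hn.symm]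
        exact Relation.EqvGen.refl _
      | succ n ih =>
        have hx : D.AtCrossing ((D.rot ^ n) d.1) := by
          clear ih hn
          induction n with
          | zero => exact hd
          | succ n ih => rw [pow_succ', Equiv.Perm.mul_apply]; exact ih.rot
        refine (ih (e := ⟨_, hx.arc⟩) rfl).trans _ _ _ (Relation.EqvGen.rel _ _ ?_)
        rw [pow_succ', Equiv.Perm.mul_apply] at hn
        by_cases hj : Joins σ ((D.rot ^ n) d.1)
        · left
          apply Subtype.ext
          rw [spliced_of_joins hj]
          exact hn.symm
        · right
          apply Subtype.ext
          rw [spliced_of_joins ((joins_dualState σ hx).2 hj)]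
          exact hn.symm
    · exact absurd hd (not_atCrossing_of_atBd h)
  · rcases eq_or_eq_cont hd h with rfl | rfl
    · exact Relation.EqvGen.refl _
    · refine Relation.EqvGen.rel _ _ (Or.inl ?_)
      rw [spliced_of_not_atCrossing hd]

/-- In the Tait graph, the corners that are joined by the splicings are the black ones. -/
theorem joins_taitState {c : D.Region → Bool} (hc : D.IsCheckerboardColouring c) {d : D.Dart}
    (h : D.AtCrossing d) : Joins (taitState c) d ↔ c (D.region d) = true := by
  have hflip : ∀ {d : D.Dart}, D.AtCrossing d →
      (c (D.region (D.rot d)) = true ↔ ¬ c (D.region d) = true) := by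
    intro d h
    have := colour_rot_ne hc (d := d) h.rot.arc
    revert this
    cases c (D.region (D.rot d)) <;> cases c (D.region d) <;> simp
  -- Being upper and being black both alternate around a crossing, so whether they agree does not
  -- depend on the dart. Hence the existential in `taitState` can be tested at `d`.
  have hinv : ∀ n : ℕ, D.AtCrossing ((D.rot ^ n) d) ∧
      ((D.upper ((D.rot ^ n) d) ↔ c (D.region ((D.rot ^ n) d)) = true) ↔
        (D.upper d ↔ c (D.region d) = true)) := by
    intro n
    induction n with
    | zero => exact ⟨h, Iff.rfl⟩
    | succ n ih =>
      obtain ⟨h1, h2⟩ := ih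
      rw [pow_succ', Equiv.Perm.mul_apply]
      refine ⟨h1.rot, ?_⟩
      rw [D.upper_rot _ h1, hflip h1]
      tauto
  have hB : taitState c (Quotient.mk _ ⟨d, h⟩) = Splice.B ↔
      (D.upper d ↔ c (D.region d) = true) := by
    have : taitState c (Quotient.mk _ ⟨d, h⟩) = Splice.B ↔
        ∃ e : {d : D.Dart // D.AtCrossing d}, (Quotient.mk _ e : D.Crossing) =
          Quotient.mk _ ⟨d, h⟩ ∧ D.upper e.1 ∧ c (D.region e.1) = true := by
      unfold taitState
      split_ifs with hx
      · exact ⟨fun _ => hx, fun _ => rfl⟩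
      · exact ⟨fun h => (by cases h), fun h => absurd h hx⟩
    rw [this]
    constructor
    · rintro ⟨e, he, hu, hce⟩
      have hs : D.rot.SameCycle d e.1 := (Quotient.exact he).symm
      obtain ⟨n, hn⟩ := hs.exists_nat_pow_eq
      have := (hinv n).2
      rw [hn] at this
      tauto
    · intro hP
      by_cases hu : D.upper d
      · exact ⟨⟨d, h⟩, rfl, hu, hP.1 hu⟩
      · refine ⟨⟨D.rot d, h.rot⟩, mk_rot d h h.rot, (D.upper_rot d h).2 hu, (hflip h).2 ?_⟩
        tauto
  constructor
  · rintro ⟨_, h1⟩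
    rw [hB] at h1
    tauto
  · intro h1
    refine ⟨h, ?_⟩
    rw [hB]
    tauto

/-! ## Counting the points of the net -/

/-- Two antipodal moves cancel, because the boundary is simple and an index on it is determined by
the point. -/
theorem samePoint_trans {d e f : D.Dart} (h1 : D.SamePoint d e) (h2 : D.SamePoint e f) :
    D.SamePoint d f := by
  rcases h1 with h1 | ⟨i, hi, hi'⟩
  · rcases h2 with h2 | ⟨j, hj, hj'⟩
    · exact Or.inl (h1.trans h2)
    · exact Or.inr ⟨j, hj.trans h1.symm, hj'⟩
  · rcases h2 with h2 | h2
    · exact Or.inr ⟨i, hi, hi'.trans h2⟩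
    · obtain ⟨j, hj, hj'⟩ := antipodal_symm h2
      left
      have : j + D.m = i + D.m := D.bd_simple _ _ (Equiv.Perm.SameCycle.trans hj' hi'.symm)
      rw [add_right_cancel this] at hj
      exact hi.symm.trans hj

theorem samePoint_of_eqvGen {d e : D.ArcDart}
    (h : Relation.EqvGen (fun d e : D.ArcDart => D.SamePoint d.1 e.1) d e) :
    D.SamePoint d.1 e.1 := by
  induction h with
  | rel x y h => exact h
  | refl x => exact Or.inl (Equiv.Perm.SameCycle.refl _ _)
  | symm x y _ ih => exact SamePoint_symm ih
  | trans x y z _ _ ih1 ih2 => exact samePoint_trans ih1 ih2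

/-- Among the darts at any point of the net, exactly two do not start an arrow. -/
theorem exists_pair_not_joins (σ : D.State) (x : D.ArcDart) :
    ∃ y z : D.ArcDart, y ≠ z ∧ ∀ w : D.ArcDart,
      (¬ Joins σ w.1 ∧ D.SamePoint x.1 w.1) ↔ (w = y ∨ w = z) := by
  by_cases hx : D.AtCrossing x.1
  -- Arrow tails alternate around a crossing; `y` and the dart opposite to it are the two without a
  -- tail.
  · obtain ⟨y, hy, hxy, hj⟩ : ∃ y, D.AtCrossing y ∧ D.rot.SameCycle x.1 y ∧ ¬ Joins σ y := by
      by_cases hj : Joins σ x.1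
      · refine ⟨D.rot x.1, hx.rot, sameCycle_rot_pow x.1 1, ?_⟩
        rw [joins_rot σ _ hx]
        exact not_not.2 hj
      · exact ⟨x.1, hx, Equiv.Perm.SameCycle.refl _ _, hj⟩
    have hj1 : Joins σ (D.rot y) := (joins_rot σ _ hy).2 hj
    have hj2 : ¬ Joins σ (D.rot (D.rot y)) := by
      rw [joins_rot σ _ hy.rot]
      exact not_not.2 hj1
    have hj3 : Joins σ (D.rot (D.rot (D.rot y))) := (joins_rot σ _ hy.rot.rot).2 hj2
    refine ⟨⟨y, hy.arc⟩, ⟨D.rot (D.rot y), hy.rot.rot.arc⟩,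
      fun h => hy.2.2.2 (congrArg Subtype.val h).symm, fun w => ⟨?_, ?_⟩⟩
    · rintro ⟨hw, h | ⟨i, h, _⟩⟩
      · obtain ⟨n, hn⟩ := (hxy.symm.trans h).exists_nat_pow_eq
        have key : ∀ n : ℕ, (D.rot ^ n) y = y ∨ (D.rot ^ n) y = D.rot y ∨
            (D.rot ^ n) y = D.rot (D.rot y) ∨ (D.rot ^ n) y = D.rot (D.rot (D.rot y)) := by
          intro n
          induction n with
          | zero => exact Or.inl rfl
          | succ n ih =>
            rw [pow_succ', Equiv.Perm.mul_apply]
            rcases ih with h | h | h | h <;> rw [h]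
            · exact Or.inr (Or.inl rfl)
            · exact Or.inr (Or.inr (Or.inl rfl))
            · exact Or.inr (Or.inr (Or.inr rfl))
            · exact Or.inl hy.2.2.1
        rcases key n with h | h | h | h <;> rw [hn] at h
        · exact Or.inl (Subtype.ext h)
        · rw [h] at hw; exact absurd hj1 hw
        · exact Or.inr (Subtype.ext h)
        · rw [h] at hw; exact absurd hj3 hw
      · exact absurd hx (not_atCrossing_of_atBd h)
    · rintro (rfl | rfl)
      · exact ⟨hj, Or.inl hxy⟩
      · exact ⟨hj2, Or.inl (hxy.trans (sameCycle_rot_pow y 2))⟩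
  · refine ⟨x, D.cont x, (cont_spec x hx).1.symm, fun w => ⟨fun h => eq_or_eq_cont hx h.2, ?_⟩⟩
    rintro (rfl | rfl)
    · exact ⟨fun h => hx h.1, Or.inl (Equiv.Perm.SameCycle.refl _ _)⟩
    · exact ⟨fun h => not_atCrossing_of_samePoint hx (cont_spec x hx).2 h.1, (cont_spec x hx).2⟩

/-- Every point has two darts that start no arrow, and each ribbon edge has two arrows. So the
number of arcs is the number of points plus the number of ribbon edges. -/
theorem card_arcDart_eq (σ : D.State) :
    Nat.card D.ArcDart = 2 * Nat.card (Classes fun d e : D.ArcDart => D.SamePoint d.1 e.1) +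
      Nat.card {d : D.ArcDart // Joins σ d.1} := by
  classical
  have := Fintype.ofFinite D.Dart
  have := Fintype.ofFinite (Classes fun d e : D.ArcDart => D.SamePoint d.1 e.1)
  rw [Nat.card_eq_fintype_card, Nat.card_eq_fintype_card, Nat.card_eq_fintype_card,
    Fintype.card_subtype (fun d : D.ArcDart => Joins σ d.1), ← Finset.card_univ (α := D.ArcDart),
    ← Finset.card_filter_add_card_filter_not (fun d : D.ArcDart => Joins σ d.1), add_comm]
  congr 1
  rw [Finset.card_eq_sum_card_fiberwise (t := Finset.univ)
    (f := (Quotient.mk _ : D.ArcDart → Classes fun d e : D.ArcDart => D.SamePoint d.1 e.1))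
    (fun _ _ => Finset.mem_coe.2 (Finset.mem_univ _))]
  rw [Finset.sum_congr rfl (g := fun _ => 2), Finset.sum_const, Finset.card_univ, smul_eq_mul,
    mul_comm]
  intro v _
  obtain ⟨x, rfl⟩ := Quotient.mk_surjective v
  obtain ⟨y, z, hne, h⟩ := exists_pair_not_joins σ x
  refine Finset.card_eq_two.2 ⟨y, z, hne, ?_⟩
  ext w
  simp only [Finset.mem_filter, Finset.mem_univ, true_and, Finset.mem_insert, Finset.mem_singleton,
    ← h w]
  refine and_congr_right fun _ => ?_
  rw [eq_comm, Quotient.eq]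
  exact ⟨samePoint_of_eqvGen, fun h =>
    Relation.EqvGen.rel (r := fun d e : D.ArcDart => D.SamePoint d.1 e.1) x w h⟩

end LinkDiagram

/-! ## Cochains with a jump at the line at infinity -/

/-- A function on the circle `ℤ/2m` that is invariant under the antipodal map has a primitive. -/
theorem exists_cyclic_primitive {m : ℕ} (hm : 0 < m) (q : ZMod (2 * m) → ZMod 2)
    (hq : ∀ i, q (i + m) = q i) : ∃ p : ZMod (2 * m) → ZMod 2, ∀ i, p i + p (i - 1) = q i := by
  have : NeZero (2 * m) := ⟨by omega⟩
  refine ⟨fun i => ∑ k ∈ Finset.range (i.val + 1), q k, fun i => ?_⟩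
  obtain ⟨j, rfl⟩ : ∃ j, i = j + 1 := ⟨i - 1, by ring⟩
  have hj : ((j.val : ℕ) : ZMod (2 * m)) = j := ZMod.natCast_zmod_val j
  have hlt := ZMod.val_lt j
  have h2 : ∀ a b : ZMod 2, a + b + a = b := by decide
  rw [add_sub_cancel_right]
  beta_reduce
  by_cases h : j.val + 1 < 2 * m
  · have h1 : (j + 1).val = j.val + 1 := by
      conv_lhs => rw [← hj, ← Nat.cast_succ]
      exact ZMod.val_natCast_of_lt h
    rw [h1, Finset.sum_range_succ, Nat.cast_succ, hj]
    exact h2 _ _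
  -- The partial sums close up around the circle: by antipodal symmetry the total is twice a
  -- half-circle sum, hence zero.
  · have h1 : j.val + 1 = m + m := by omega
    have h3 : j + 1 = 0 := by
      rw [← hj, ← Nat.cast_add_one, h1, ← two_mul]
      exact ZMod.natCast_self _
    have h4 : ∀ k : ℕ, q ((m + k : ℕ) : ZMod (2 * m)) = q k := by
      intro k
      rw [Nat.cast_add, add_comm, hq]
    have h5 : ∑ k ∈ Finset.range (j.val + 1), q k = 0 := by
      rw [h1, Finset.sum_range_add]
      simp only [h4, CharTwo.add_self_eq_zero]
    rw [h3, h5, ZMod.val_zero]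
    simp

/-- The dimension of a space of pairs in terms of the second components. -/
theorem finrank_submodule_prod {M : Type} [AddCommGroup M] [Module (ZMod 2) M]
    [FiniteDimensional (ZMod 2) M] (W : Submodule (ZMod 2) (M × ZMod 2)) :
    ((∃ f, (f, 1) ∈ W) → Module.finrank (ZMod 2) W =
      Module.finrank (ZMod 2) (W.comap (LinearMap.inl (ZMod 2) M (ZMod 2))) + 1) ∧
    ((¬ ∃ f, (f, 1) ∈ W) → Module.finrank (ZMod 2) W =
      Module.finrank (ZMod 2) (W.comap (LinearMap.inl (ZMod 2) M (ZMod 2)))) := by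
  let p : W →ₗ[ZMod 2] ZMod 2 := LinearMap.snd (ZMod 2) M (ZMod 2) ∘ₗ W.subtype
  let j : W.comap (LinearMap.inl (ZMod 2) M (ZMod 2)) →ₗ[ZMod 2] W :=
    (LinearMap.inl (ZMod 2) M (ZMod 2)).restrict fun _ h => h
  have hj : Function.Injective j := by
    intro a b h
    exact Subtype.ext (congrArg (fun z : W => z.1.1) h)
  have hker : LinearMap.ker p = LinearMap.range j := by
    ext ⟨⟨f, e⟩, hf⟩
    rw [LinearMap.mem_ker]
    constructor
    · intro h
      obtain rfl : e = 0 := h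
      exact ⟨⟨f, hf⟩, rfl⟩
    · rintro ⟨g, hg⟩
      exact (congrArg (fun z : W => z.1.2) hg).symm
  have h := LinearMap.finrank_range_add_finrank_ker p
  rw [hker, LinearMap.finrank_range_of_inj hj] at h
  constructor
  · rintro ⟨f, hf⟩
    have : LinearMap.range p = ⊤ := by
      rw [LinearMap.range_eq_top]
      intro a
      exact ⟨a • ⟨(f, 1), hf⟩, mul_one a⟩
    rw [this, finrank_top, Module.finrank_self] at h
    omega
  · intro hn
    have : LinearMap.range p = ⊥ := by
      rw [LinearMap.range_eq_bot]
      ext ⟨⟨f, e⟩, hf⟩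
      have h01 : ∀ e : ZMod 2, e ≠ 1 → e = 0 := by decide
      exact h01 e fun he => hn ⟨f, he ▸ hf⟩
    rw [this, finrank_bot] at h
    omega

namespace LinkDiagram

variable {D : LinkDiagram}

theorem natCast_m_ne_zero : (D.m : ZMod (2 * D.m)) ≠ 0 := by
  have := D.m_pos
  rw [Ne, ZMod.natCast_eq_zero_iff]
  intro h
  have := Nat.le_of_dvd D.m_pos h
  omega

theorem not_antipodal_of_sameCycle {d e : D.Dart} (hs : D.rot.SameCycle d e) :
    ¬ D.Antipodal d e := by
  rintro ⟨i, h1, h2⟩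
  have := D.bd_simple _ _ ((h1.trans hs).trans h2.symm)
  exact natCast_m_ne_zero (left_eq_add.1 this)

variable (D) in
/-- The functions on the points of the disc that jump by a constant between antipodal points. -/
def jumpFns : Submodule (ZMod 2) ((D.ArcDart → ZMod 2) × ZMod 2) where
  carrier := {p | (∀ d e : D.ArcDart, D.rot.SameCycle d.1 e.1 → p.1 e = p.1 d) ∧
    ∀ d e : D.ArcDart, D.Antipodal d.1 e.1 → p.1 e = p.1 d + p.2}
  add_mem' := by
    rintro p q ⟨h1, h2⟩ ⟨h3, h4⟩
    refine ⟨fun d e h => ?_, fun d e h => ?_⟩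
    · simp only [Prod.fst_add, Pi.add_apply, h1 d e h, h3 d e h]
    · simp only [Prod.fst_add, Prod.snd_add, Pi.add_apply, h2 d e h, h4 d e h]
      ring
  zero_mem' := ⟨fun _ _ _ => rfl, fun _ _ _ => rfl⟩
  smul_mem' := by
    rintro a p ⟨h1, h2⟩
    refine ⟨fun d e h => ?_, fun d e h => ?_⟩
    · simp only [Prod.smul_fst, Pi.smul_apply, h1 d e h]
    · simp only [Prod.smul_fst, Prod.smul_snd, Pi.smul_apply, h2 d e h, smul_add]

theorem mem_jumpFns {u : D.ArcDart → ZMod 2} {ε : ZMod 2} : (u, ε) ∈ D.jumpFns ↔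
    (∀ d e : D.ArcDart, D.rot.SameCycle d.1 e.1 → u e = u d) ∧
    ∀ d e : D.ArcDart, D.Antipodal d.1 e.1 → u e = u d + ε := Iff.rfl

theorem comap_inl_jumpFns : D.jumpFns.comap (LinearMap.inl _ _ _) =
    invariantFns fun d e : D.ArcDart => D.SamePoint d.1 e.1 := by
  ext f
  rw [Submodule.mem_comap, LinearMap.inl_apply, mem_jumpFns, mem_invariantFns]
  constructor
  · rintro ⟨h1, h2⟩ d e (h | h)
    · exact (h1 d e h).symm
    · rw [h2 d e h, add_zero]
  · intro h
    exact ⟨fun d e hs => (h d e (Or.inl hs)).symm,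
      fun d e hs => by rw [add_zero]; exact (h d e (Or.inr hs)).symm⟩

/-- The indicator function of a half circle, extended by zero to the interior points, jumps by 1
between antipodes. -/
theorem exists_jump : ∃ f, (f, 1) ∈ D.jumpFns := by
  classical
  have : NeZero (2 * D.m) := ⟨by have := D.m_pos; omega⟩
  let β : ZMod (2 * D.m) → ZMod 2 := fun i => if i.val < D.m then 0 else 1
  have hβ : ∀ i, β (i + D.m) = β i + 1 := by
    intro i
    have hm := D.m_pos
    have hi := ZMod.val_lt i
    have h1 : (i + D.m).val = (i.val + D.m) % (2 * D.m) := by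
      rw [ZMod.val_add, ZMod.val_natCast_of_lt (by omega)]
    simp only [β, h1]
    by_cases h : i.val < D.m
    · rw [if_pos h, Nat.mod_eq_of_lt (by omega), if_neg (by omega), zero_add]
    · rw [if_neg h, Nat.mod_eq_sub_mod (by omega), Nat.mod_eq_of_lt (by omega), if_pos (by omega)]
      rfl
  let f : D.ArcDart → ZMod 2 := fun d => if h : ∃ i, D.AtBd i d.1 then β h.choose else 0
  have hf : ∀ (d : D.ArcDart) i, D.AtBd i d.1 → f d = β i := by
    intro d i hi
    have h : ∃ i, D.AtBd i d.1 := ⟨i, hi⟩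
    have : h.choose = i := D.bd_simple _ _ (h.choose_spec.trans hi.symm)
    simp only [f]
    rw [dif_pos h, this]
  refine ⟨f, fun d e hs => ?_, ?_⟩
  · by_cases h : ∃ i, D.AtBd i d.1
    · obtain ⟨i, hi⟩ := h
      simp only [hf d i hi, hf e i (hi.trans hs)]
    · have h' : ¬ ∃ i, D.AtBd i e.1 := fun ⟨i, hi⟩ => h ⟨i, hi.trans hs.symm⟩
      simp only [f]
      rw [dif_neg h, dif_neg h']
  · rintro d e ⟨i, h1, h2⟩
    simp only [hf d i h1, hf e _ h2, hβ]

theorem finrank_jumpFns : Module.finrank (ZMod 2) D.jumpFns =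
    Nat.card (Classes fun d e : D.ArcDart => D.SamePoint d.1 e.1) + 1 := by
  rw [(finrank_submodule_prod _).1 exists_jump, comap_inl_jumpFns, finrank_invariantFns]

variable (D) in
/-- The coboundaries of the functions with a jump. -/
def jumpCoboundary : (D.ArcDart → ZMod 2) × ZMod 2 →ₗ[ZMod 2] (D.ArcDart → ZMod 2) :=
  coboundary revArc ∘ₗ LinearMap.fst _ _ _

variable (D) in
/-- A function that jumps at the line at infinity and is constant along the curves. -/
def IsPotential (t : D.ArcDart → ZMod 2) : Prop :=
  (t, 1) ∈ D.jumpFns ∧ ∀ d, t (revArc d) = t d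

/-- Rank-nullity: in the kernel, the functions without jump are the constants by connectedness, and
those with jump 1 are the potentials. -/
theorem finrank_map_jumpCoboundary (hconn : D.Connected) :
    ((∃ t, D.IsPotential t) → Module.finrank (ZMod 2) (D.jumpFns.map D.jumpCoboundary) + 1 =
      Nat.card (Classes fun d e : D.ArcDart => D.SamePoint d.1 e.1)) ∧
    ((¬ ∃ t, D.IsPotential t) → Module.finrank (ZMod 2) (D.jumpFns.map D.jumpCoboundary) =
      Nat.card (Classes fun d e : D.ArcDart => D.SamePoint d.1 e.1)) := by
  have h2 : ∀ a b : ZMod 2, a + b = 0 ↔ b = a := by decide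
  have h3 := LinearMap.finrank_range_add_finrank_ker (D.jumpCoboundary.domRestrict D.jumpFns)
  rw [LinearMap.range_domRestrict, LinearMap.ker_domRestrict, finrank_jumpFns] at h3
  let K := D.jumpFns ⊓ LinearMap.ker D.jumpCoboundary
  have hK : Module.finrank (ZMod 2) ((LinearMap.ker D.jumpCoboundary).comap D.jumpFns.subtype) =
      Module.finrank (ZMod 2) K := by
    rw [show K = D.jumpFns ⊓ LinearMap.ker D.jumpCoboundary from rfl,
      ← Submodule.map_comap_subtype]
    exact (LinearEquiv.finrank_eq (Submodule.equivMapOfInjective _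
      D.jumpFns.injective_subtype _))
  rw [hK] at h3
  have hpot : ∀ t, (t, 1) ∈ K ↔ D.IsPotential t := by
    intro t
    refine and_congr_right fun _ => ?_
    rw [SetLike.mem_coe, LinearMap.mem_ker]
    exact ⟨fun h d => (h2 _ _).1 (congrFun h d), fun h => funext fun d => (h2 _ _).2 (h d)⟩
  have hinl : K.comap (LinearMap.inl _ _ _) =
      invariantFns fun d e : D.ArcDart => e.1 = D.rev d.1 ∨ D.SamePoint d.1 e.1 := by
    ext f
    rw [Submodule.comap_inf, Submodule.mem_inf, comap_inl_jumpFns]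
    constructor
    · rintro ⟨h4, h5⟩ d e (h | h)
      · rw [show e = revArc d from Subtype.ext h]
        exact ((h2 _ _).1 (congrFun h5 d)).symm
      · exact h4 d e h
    · intro h
      exact ⟨fun d e hs => h d e (Or.inr hs),
        funext fun d => (h2 _ _).2 (h d (revArc d) (Or.inl rfl)).symm⟩
  have hone : Module.finrank (ZMod 2) (K.comap (LinearMap.inl _ _ _)) = 1 := by
    rw [hinl, finrank_invariantFns, Nat.card_eq_one_iff_unique]
    refine ⟨⟨fun a b => ?_⟩, hconn.1.map (Quotient.mk _)⟩
    induction a, b using Quotient.inductionOn₂ with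
    | h a b => exact Quotient.sound (hconn.2 a b)
  have h4 := finrank_submodule_prod K
  simp only [hpot, hone] at h4
  constructor
  · intro h
    have := h4.1 h
    omega
  · intro h
    have := h4.2 h
    omega

/-! ## The cocycles of the Tait graph -/

/-- The functions on the points of the curves of the spliced diagram. -/
abbrev curveFns (σ : D.State) : Submodule (ZMod 2) (D.ArcDart → ZMod 2) :=
  invariantFns fun d e : D.ArcDart => e = spliced σ d

theorem mem_curveFns {σ : D.State} {f : D.ArcDart → ZMod 2} :
    f ∈ curveFns σ ↔ ∀ d, f (spliced σ d) = f d :=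
  ⟨fun h d => (h d _ rfl).symm, by rintro h d _ rfl; exact (h d).symm⟩

/-- The differences of a pair of functions on the points of the black and white curves along
the black and white sides of the arcs. -/
def sideDiff (c : D.Region → Bool) (σ : D.State) :
    (curveFns σ × curveFns (dualState σ)) →ₗ[ZMod 2] (D.ArcDart → ZMod 2) where
  toFun p d := if c (D.region d.1) then p.1.1 d + p.1.1 (revArc d) else p.2.1 d + p.2.1 (revArc d)
  map_add' p q := by
    funext d
    simp only [Pi.add_apply, Prod.fst_add, Prod.snd_add, Submodule.coe_add]
    split_ifs <;> ring
  map_smul' a p := by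
    funext d
    simp only [Pi.smul_apply, Prod.smul_fst, Prod.smul_snd, Submodule.coe_smul, smul_eq_mul,
      RingHom.id_apply]
    split_ifs <;> ring

theorem sideDiff_apply (c : D.Region → Bool) (σ : D.State)
    (p : curveFns σ × curveFns (dualState σ)) (d : D.ArcDart) :
    sideDiff c σ p d =
      if c (D.region d.1) then p.1.1 d + p.1.1 (revArc d) else p.2.1 d + p.2.1 (revArc d) := rfl

theorem colour_revArc {c : D.Region → Bool} (hc : D.IsCheckerboardColouring c) (d : D.ArcDart) :
    c (D.region (revArc d).1) = !c (D.region d.1) := by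
  have := hc d.1 d.2
  change c (D.region (D.rev d.1)) = _
  revert this
  cases c (D.region d.1) <;> cases c (D.region (D.rev d.1)) <;> simp

/-- Exactly one side of an arc is black, so the discrepancy compares the black difference with the
white one. -/
theorem coboundary_sideDiff {c : D.Region → Bool} (hc : D.IsCheckerboardColouring c) (σ : D.State)
    (p : curveFns σ × curveFns (dualState σ)) (d : D.ArcDart) :
    coboundary revArc (sideDiff c σ p) d =
      p.1.1 d + p.1.1 (revArc d) + (p.2.1 d + p.2.1 (revArc d)) := by
  rw [coboundary_apply, sideDiff_apply, sideDiff_apply, colour_revArc hc, revArc_revArc]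
  cases c (D.region d.1)
  · simp only [Bool.not_false, if_true]; simp; ring
  · simp; ring

theorem sum_curveFns [Fintype D.ArcDart] {σ : D.State} {f : D.ArcDart → ZMod 2} (hf : f ∈ curveFns σ) :
    ∑ d, f d = 0 := by
  refine Finset.sum_involution (fun d _ => spliced σ d) (fun d _ => ?_) (fun d _ _ => spliced_ne σ d)
    (fun _ _ => Finset.mem_univ _) (fun d _ => spliced_spliced σ d)
  rw [mem_curveFns.1 hf]
  exact CharTwo.add_self_eq_zero _

theorem sum_sideDiff [Fintype D.ArcDart] {c : D.Region → Bool} (hc : D.IsCheckerboardColouring c)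
    (σ : D.State) (p : curveFns σ × curveFns (dualState σ)) : ∑ d, sideDiff c σ p d = 0 := by
  let R : Equiv.Perm D.ArcDart := ⟨revArc, revArc, revArc_revArc, revArc_revArc⟩
  -- The far end of an arc is the near end of its reversal, whose colour is opposite. After
  -- reindexing, every value of both functions occurs once, and each total vanishes since splicing
  -- pairs equal values.
  have h1 : ∀ d, sideDiff c σ p d = (if c (D.region d.1) then p.1.1 d else p.2.1 d) +
      if c (D.region (R d).1) then p.2.1 (R d) else p.1.1 (R d) := by
    intro d
    rw [sideDiff_apply, show R d = revArc d from rfl, colour_revArc hc]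
    cases c (D.region d.1) <;> simp
  rw [Finset.sum_congr rfl fun d _ => h1 d, Finset.sum_add_distrib,
    Equiv.sum_comp R fun d => if c (D.region d.1) then p.2.1 d else p.1.1 d,
    ← Finset.sum_add_distrib]
  have h2 : ∀ d : D.ArcDart, ((if c (D.region d.1) then p.1.1 d else p.2.1 d) +
      if c (D.region d.1) then p.2.1 d else p.1.1 d) = p.1.1 d + p.2.1 d := by
    intro d
    split_ifs
    · rfl
    · exact add_comm _ _
  rw [Finset.sum_congr rfl fun d _ => h2 d, Finset.sum_add_distrib, sum_curveFns p.1.2,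
    sum_curveFns p.2.2, add_zero]

theorem single_add_single_mem_curveFns [DecidableEq D.ArcDart] (σ : D.State) (d : D.ArcDart) :
    (Pi.single d 1 + Pi.single (spliced σ d) 1 : D.ArcDart → ZMod 2) ∈ curveFns σ := by
  refine mem_curveFns.2 fun z => ?_
  have e1 : spliced σ z = d ↔ z = spliced σ d :=
    ⟨fun h => by rw [← h, spliced_spliced], fun h => by rw [h, spliced_spliced]⟩
  have e2 : spliced σ z = spliced σ d ↔ z = d :=
    ⟨fun h => by rw [← spliced_spliced σ z, h, spliced_spliced], fun h => by rw [h]⟩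
  simp only [Pi.add_apply, Pi.single_apply, e1, e2]
  exact add_comm _ _

theorem isChainConnected_spliced (hconn : D.Connected) (σ : D.State) :
    IsChainConnected fun d e : D.ArcDart =>
      e = revArc d ∨ e = spliced σ d ∨ e = spliced (dualState σ) d := by
  refine ⟨hconn.1, fun d e => ?_⟩
  have h := hconn.2 d e
  induction h with
  | rel x y h =>
    rcases h with h | h
    · exact Relation.EqvGen.rel _ _ (Or.inl (Subtype.ext h))
    · exact (eqvGen_of_samePoint σ h).mono fun _ _ => Or.inr
  | refl x => exact Relation.EqvGen.refl _
  | symm x y _ ih => exact ih.symm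
  | trans x y z _ _ ih1 ih2 => exact ih1.trans _ _ _ ih2

/-- Taking a dart and its reverse together, both functions of the pair have to be constant along
every arc, hence on each spliced curve. -/
theorem finrank_ker_sideDiff {c : D.Region → Bool} (hc : D.IsCheckerboardColouring c)
    (σ : D.State) : Module.finrank (ZMod 2) (LinearMap.ker (sideDiff c σ)) =
      Nat.card (Classes fun d e : D.ArcDart => e = revArc d ∨ e = spliced σ d) +
      Nat.card (Classes fun d e : D.ArcDart => e = revArc d ∨ e = spliced (dualState σ) d) := by
  have h2 : ∀ a b : ZMod 2, a + b = 0 ↔ a = b := by decide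
  have hle : ∀ σ : D.State,
      (invariantFns fun d e : D.ArcDart => e = revArc d ∨ e = spliced σ d) ≤ curveFns σ :=
    fun σ f hf d e h => hf d e (Or.inr h)
  let j := LinearMap.prodMap (Submodule.inclusion (hle σ)) (Submodule.inclusion (hle (dualState σ)))
  have hj : Function.Injective j :=
    Function.Injective.prodMap (Submodule.inclusion_injective (hle σ))
      (Submodule.inclusion_injective (hle (dualState σ)))
  have hker : LinearMap.ker (sideDiff c σ) = LinearMap.range j := by
    ext ⟨⟨b, hb⟩, ⟨w, hw⟩⟩
    rw [LinearMap.mem_ker]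
    constructor
    · intro h
      have hd : ∀ d : D.ArcDart, (if c (D.region d.1) then b d + b (revArc d) else
          w d + w (revArc d)) = 0 := fun d => congrFun h d
      have hbw : ∀ d, b d = b (revArc d) ∧ w d = w (revArc d) := by
        intro d
        have e1 := hd d
        have e2 := hd (revArc d)
        rw [colour_revArc hc, revArc_revArc] at e2
        cases hcd : c (D.region d.1) <;> rw [hcd] at e1 e2 <;> simp [h2] at e1 e2
        · exact ⟨e2.symm, e1⟩
        · exact ⟨e1, e2.symm⟩
      refine ⟨⟨⟨b, ?_⟩, ⟨w, ?_⟩⟩, rfl⟩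
      · rintro d e (rfl | h)
        · exact (hbw d).1
        · exact hb d e h
      · rintro d e (rfl | h)
        · exact (hbw d).2
        · exact hw d e h
    · rintro ⟨⟨⟨b', hb'⟩, ⟨w', hw'⟩⟩, h⟩
      obtain rfl : b' = b := congrArg (fun z => z.1.1) h
      obtain rfl : w' = w := congrArg (fun z => z.2.1) h
      funext d
      rw [sideDiff_apply]
      simp only [← hb' d _ (Or.inl rfl), ← hw' d _ (Or.inl rfl), CharTwo.add_self_eq_zero,
        ite_self, Pi.zero_apply]
  rw [hker, LinearMap.finrank_range_of_inj hj, Module.finrank_prod, finrank_invariantFns,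
    finrank_invariantFns]

/-- This applies `finrank_cocycles` to the closed surface made of discs on the curves of `σ` and of
its dual; values at the points of these curves play the role of the corners. -/
theorem finrank_cocycles_sideDiff (hconn : D.Connected) {c : D.Region → Bool}
    (hc : D.IsCheckerboardColouring c) (σ : D.State) :
    2 * Module.finrank (ZMod 2) (cocycles revArc (sideDiff c σ)) +
      2 * (Nat.card (Classes fun d e : D.ArcDart => e = revArc d ∨ e = spliced σ d) +
      Nat.card (Classes fun d e : D.ArcDart => e = revArc d ∨ e = spliced (dualState σ) d)) =
    Nat.card D.ArcDart + 2 := by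
  classical
  have : Fintype D.ArcDart := Fintype.ofFinite _
  rw [← finrank_ker_sideDiff hc σ]
  have h4 : ∀ a b : ZMod 2, 0 = a + b + (b + a) := by decide
  have hsingle : ∀ x z : D.ArcDart, (Pi.single x 1 : D.ArcDart → ZMod 2) (revArc z) =
      (Pi.single (revArc x) 1 : D.ArcDart → ZMod 2) z := by
    intro x z
    have e : revArc z = x ↔ z = revArc x :=
      ⟨fun h => by rw [← h, revArc_revArc], fun h => by rw [h, revArc_revArc]⟩
    simp only [Pi.single_apply, e]
  refine finrank_cocycles revArc_revArc revArc_ne _ (sum_sideDiff hc σ)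
    (isChainConnected_spliced hconn σ) ?_ ?_
  · rintro x y (rfl | rfl | rfl)
    · refine ⟨0, ?_⟩
      rw [revArc_revArc, map_zero, map_zero]
      exact funext fun _ => h4 _ _
    -- A unit change at the single curve point shared by `x` and `spliced σ x` affects just the arcs
    -- of these two darts.
    · refine ⟨(⟨_, single_add_single_mem_curveFns σ x⟩, 0), funext fun z => ?_⟩
      rw [coboundary_sideDiff hc]
      simp only [Pi.add_apply, hsingle, Submodule.coe_zero, Pi.zero_apply]
      ring
    · refine ⟨(0, ⟨_, single_add_single_mem_curveFns (dualState σ) x⟩), funext fun z => ?_⟩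
      rw [coboundary_sideDiff hc]
      simp only [Pi.add_apply, hsingle, Submodule.coe_zero, Pi.zero_apply]
      ring
  -- Each of the two splicings pairs all arc darts, so each family of curves contributes half of
  -- them as points.
  · have h1 := card_eq_two_mul_classes (spliced_spliced σ) (spliced_ne σ)
    have h2 := card_eq_two_mul_classes (spliced_spliced (dualState σ)) (spliced_ne (dualState σ))
    rw [Module.finrank_prod, finrank_invariantFns, finrank_invariantFns]
    omega

end LinkDiagram

namespace LinkDiagram

variable {D : LinkDiagram}

/-! ## Extending cocycles over the regions -/

theorem eq_of_samePoint_of_curveFns {σ : D.State} {v : D.ArcDart → ZMod 2} (hv : v ∈ curveFns σ)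
    {d e : D.ArcDart} (hd : ¬ D.AtCrossing d.1) (h : D.SamePoint d.1 e.1) : v e = v d := by
  rcases eq_or_eq_cont hd h with rfl | rfl
  · rfl
  · rw [← spliced_of_not_atCrossing (σ := σ) hd, mem_curveFns.1 hv]

open Classical in
/-- Extending a function on the points of a spliced diagram to all darts that start at the same
points of the net, and by zero elsewhere. -/
noncomputable def extendFn (v : D.ArcDart → ZMod 2) (d : D.Dart) : ZMod 2 :=
  if h : D.arc d then v ⟨d, h⟩
  else if h : ∃ e : D.ArcDart, D.SamePoint d e.1 then v h.choose else 0

theorem extendFn_of_arc (v : D.ArcDart → ZMod 2) (d : D.ArcDart) : extendFn v d.1 = v d := by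
  rw [extendFn, dif_pos d.2]

/-- Away from crossings the chosen dart is irrelevant: the two arc darts at such a point are joined
by the splicing and have equal values. -/
theorem extendFn_eq {σ : D.State} {v : D.ArcDart → ZMod 2} (hv : v ∈ curveFns σ) {d : D.Dart}
    (hd : ¬ D.AtCrossing d) {e : D.ArcDart} (h : D.SamePoint d e.1) : extendFn v d = v e := by
  by_cases ha : D.arc d
  · rw [extendFn, dif_pos ha]
    exact (eq_of_samePoint_of_curveFns hv (d := ⟨d, ha⟩) hd h).symm
  · have hex : ∃ e : D.ArcDart, D.SamePoint d e.1 := ⟨e, h⟩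
    rw [extendFn, dif_neg ha, dif_pos hex]
    exact eq_of_samePoint_of_curveFns hv (not_atCrossing_of_samePoint hd h)
      (samePoint_trans (SamePoint_symm h) hex.choose_spec)

theorem extendFn_samePoint {σ : D.State} {v : D.ArcDart → ZMod 2} (hv : v ∈ curveFns σ)
    {d e : D.Dart} (hd : ¬ D.AtCrossing d) (h : D.SamePoint d e) :
    extendFn v d = extendFn v e := by
  have he := not_atCrossing_of_samePoint hd h
  by_cases hx : ∃ f : D.ArcDart, D.SamePoint d f.1
  · obtain ⟨f, hf⟩ := hx
    rw [extendFn_eq hv hd hf, extendFn_eq hv he (samePoint_trans (SamePoint_symm h) hf)]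
  · have hx' : ¬ ∃ f : D.ArcDart, D.SamePoint e f.1 := fun ⟨f, hf⟩ => hx ⟨f, samePoint_trans h hf⟩
    have h1 : ¬ D.arc d := fun ha => hx ⟨⟨d, ha⟩, Or.inl (Equiv.Perm.SameCycle.refl _ _)⟩
    have h2 : ¬ D.arc e := fun ha => hx' ⟨⟨e, ha⟩, Or.inl (Equiv.Perm.SameCycle.refl _ _)⟩
    rw [extendFn, dif_neg h1, dif_neg hx, extendFn, dif_neg h2, dif_neg hx']

theorem sameCycle_rot_inv (d : D.Dart) : D.rot.SameCycle d (D.rot⁻¹ d) :=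
  ⟨-1, by rw [zpow_neg_one]⟩

/-- Moving to the neighbouring dart keeps the value, except at crossing corners that `σ` does not
join. -/
theorem extendFn_rot_inv {σ : D.State} {v : D.ArcDart → ZMod 2} (hv : v ∈ curveFns σ)
    {d : D.Dart} (h : D.AtCrossing d → Joins σ (D.rot⁻¹ d)) :
    extendFn v (D.rot⁻¹ d) = extendFn v d := by
  by_cases hd : D.AtCrossing d
  · have e : D.rot (D.rot⁻¹ d) = d := D.rot.apply_symm_apply _
    have h1 : spliced σ ⟨D.rot⁻¹ d, hd.rot_inv.arc⟩ = ⟨d, hd.arc⟩ :=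
      Subtype.ext ((spliced_of_joins (h hd)).trans e)
    rw [extendFn_of_arc v ⟨_, hd.rot_inv.arc⟩, extendFn_of_arc v ⟨_, hd.arc⟩, ← h1,
      mem_curveFns.1 hv]
  · exact (extendFn_samePoint hv hd (Or.inl (sameCycle_rot_inv d))).symm

/-- The antipodal jump of a function on the points of the disc is constant if its coboundary is
antipodally symmetric on the boundary circle. -/
theorem antipodal_jump {u : D.Dart → ZMod 2} (hu : ∀ d, u (D.rot d) = u d)
    (h : ∀ i, u (D.bd (i + D.m)) + u (D.rev (D.bd (i + D.m))) = u (D.bd i) + u (D.rev (D.bd i)))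
    {d e : D.Dart} (hde : D.Antipodal d e) : u e = u d + (u (D.bd 0) + u (D.bd D.m)) := by
  have : NeZero (2 * D.m) := ⟨by have := D.m_pos; omega⟩
  have hrev : ∀ i, u (D.rev (D.bd i)) = u (D.bd (i + 1)) := fun i => by rw [← D.rot_rev_bd, hu]
  have hcyc : ∀ {d e}, D.rot.SameCycle d e → u d = u e := by
    intro d e hs
    obtain ⟨n, rfl⟩ := hs.exists_nat_pow_eq
    clear hs
    induction n with
    | zero => rfl
    | succ n ih => rw [pow_succ', Equiv.Perm.mul_apply, hu, ih]
  -- The jump is carried once around the circle: by hypothesis `u` changes by the same amount along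
  -- an edge and along its antipode.
  have hn : ∀ n : ℕ, u (D.bd n) + u (D.bd (n + D.m)) = u (D.bd 0) + u (D.bd D.m) := by
    intro n
    induction n with
    | zero => simp
    | succ n ih =>
      have h1 := h n
      rw [hrev, hrev] at h1
      rw [← ih, Nat.cast_succ, add_right_comm]
      have h2 : ∀ a b c d : ZMod 2, a + b = c + d → d + b = c + a := by decide
      exact h2 _ _ _ _ h1
  obtain ⟨i, h1, h2⟩ := hde
  have h3 := hn i.val
  rw [ZMod.natCast_zmod_val] at h3
  rw [← h3, ← hcyc h1, ← hcyc h2]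
  have h4 : ∀ a b : ZMod 2, b = a + (a + b) := by decide
  exact h4 _ _

/-- Extends a cocycle over the regions by taking, on each auxiliary edge, the difference of the
extended primitive of the colour of its region. The result is closed on all cells of the disc and
antipodally symmetric on the boundary, so `exists_primitive` and `antipodal_jump` apply. Only this
inclusion needs the state to follow the black regions: the primitives must agree across every corner
of a region. -/
theorem cocycles_le {c : D.Region → Bool} (hc : D.IsCheckerboardColouring c) :
    cocycles revArc (sideDiff c (taitState c)) ≤ D.jumpFns.map D.jumpCoboundary := by
  classical
  intro f hf
  obtain ⟨⟨⟨⟨b, hb⟩, ⟨w, hw⟩⟩, hp⟩, hsym⟩ := mem_cocycles.1 hf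
  have hp' : ∀ d : D.ArcDart, (if c (D.region d.1) then b d + b (revArc d)
      else w d + w (revArc d)) = f d := fun d => congrFun hp d
  -- `G₀ d` is the value at the corner where `d` starts, within the cell on its left; `f₁ d` is its
  -- difference along `d`.
  let G₀ : D.Dart → ZMod 2 := fun d => if c (D.region d) then extendFn b d else extendFn w d
  let f₁ : D.Dart → ZMod 2 := fun d => G₀ d + G₀ (D.rot⁻¹ (D.rev d))
  have hf₁ : ∀ d, (∀ i, d ≠ D.rev (D.bd i)) → f₁ d = if c (D.region d) then
      extendFn b d + extendFn b (D.rot⁻¹ (D.rev d)) else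
      extendFn w d + extendFn w (D.rot⁻¹ (D.rev d)) := by
    intro d hd
    simp only [f₁, G₀]
    rw [region_cell hd]
    split_ifs <;> rfl
  have hext : ∀ d, D.arc d → ∀ i, d ≠ D.rev (D.bd i) := by
    rintro d hd i rfl
    have := D.arc_rev _ hd
    rw [D.rev_rev] at this
    exact D.not_arc_bd i this
  have harc : ∀ d : D.ArcDart, f₁ d.1 = f d := by
    intro d
    have hcell := region_cell (hext d.1 d.2)
    have hx : D.AtCrossing (D.rev d.1) → (Joins (taitState c) (D.rot⁻¹ (D.rev d.1)) ↔
        c (D.region d.1) = true) := by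
      intro h
      rw [joins_taitState hc h.rot_inv, hcell]
    have hx' : D.AtCrossing (D.rev d.1) → (Joins (dualState (taitState c)) (D.rot⁻¹ (D.rev d.1)) ↔
        ¬ c (D.region d.1) = true) := by
      intro h
      rw [joins_dualState _ h.rot_inv, hx h]
    rw [hf₁ _ (hext d.1 d.2), ← hp' d]
    split_ifs with hcd
    · rw [extendFn_rot_inv hb fun h => (hx h).2 hcd, extendFn_of_arc b d,
        extendFn_of_arc b ⟨_, D.arc_rev _ d.2⟩]
      rfl
    · rw [extendFn_rot_inv hw fun h => (hx' h).2 hcd, extendFn_of_arc w d,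
        extendFn_of_arc w ⟨_, D.arc_rev _ d.2⟩]
      rfl
  -- Both sides of an auxiliary edge belong to one region, so they use the same primitive, and no
  -- end of the edge is a crossing.
  have hnonarc : ∀ d, ¬ D.arc d → (∀ i, d ≠ D.bd i) → (∀ i, d ≠ D.rev (D.bd i)) →
      f₁ (D.rev d) = f₁ d := by
    intro d hd h1 h2
    have hrev : ¬ D.arc (D.rev d) := fun h => hd (by rw [← D.rev_rev d]; exact D.arc_rev _ h)
    rw [hf₁ d h2, hf₁ (D.rev d) fun i hi => h1 i (D.rev.injective hi), region_rev hd, D.rev_rev,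
      extendFn_rot_inv hb fun h => absurd h.arc hd, extendFn_rot_inv hw fun h => absurd h.arc hd,
      extendFn_rot_inv hb fun h => absurd h.arc hrev, extendFn_rot_inv hw fun h => absurd h.arc hrev,
      add_comm, add_comm (extendFn w _)]
  have hbd_ne : ∀ i j, D.bd i ≠ D.rev (D.bd j) := fun i j h => D.rev_bd_ne j i h.symm
  have hbd : ∀ i, f₁ (D.bd (i + D.m)) = f₁ (D.bd i) := by
    intro i
    have hrot : ∀ {v : D.ArcDart → ZMod 2} {σ : D.State}, v ∈ curveFns σ → ∀ j,
        extendFn v (D.rot⁻¹ (D.rev (D.bd j))) = extendFn v (D.bd (j + 1)) := by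
      intro v σ hv j
      have hs : D.rot.SameCycle (D.bd (j + 1)) (D.rot⁻¹ (D.rev (D.bd j))) := by
        refine ⟨-2, ?_⟩
        rw [← D.rot_rev_bd, ← Equiv.Perm.mul_apply, ← zpow_add_one, ← zpow_neg_one]
        rfl
      exact (extendFn_samePoint hv (not_atCrossing_of_atBd (Equiv.Perm.SameCycle.refl _ _))
        (Or.inl hs)).symm
    have hant : ∀ {v : D.ArcDart → ZMod 2} {σ : D.State}, v ∈ curveFns σ → ∀ j,
        extendFn v (D.bd (j + D.m)) = extendFn v (D.bd j) := by
      intro v σ hv j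
      exact (extendFn_samePoint hv (not_atCrossing_of_atBd (Equiv.Perm.SameCycle.refl _ _))
        (Or.inr ⟨j, Equiv.Perm.SameCycle.refl _ _, Equiv.Perm.SameCycle.refl _ _⟩)).symm
    rw [hf₁ _ (hbd_ne _), hf₁ _ (hbd_ne _), hrot hb, hrot hb, hrot hw, hrot hw,
      add_right_comm i _ 1, hant hb, hant hb, hant hw, hant hw, region_bd_antipode]
  -- The exterior is not part of a region, so its corner values `p` are obtained from the symmetry
  -- of `f₁` on the circle; `G` uses them on the exterior darts.
  obtain ⟨p, hpp⟩ := exists_cyclic_primitive D.m_pos (fun i => f₁ (D.bd i)) hbd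
  let G : D.Dart → ZMod 2 := fun d =>
    if h : ∃ i, d = D.rev (D.bd i) then p h.choose else G₀ d
  have hG_ext : ∀ i, G (D.rev (D.bd i)) = p i := by
    intro i
    have h : ∃ j, D.rev (D.bd i) = D.rev (D.bd j) := ⟨i, rfl⟩
    have h1 : h.choose = i := by
      apply D.bd_simple
      rw [D.rev.injective h.choose_spec.symm]
    simp only [G]
    rw [dif_pos h, h1]
  have hG_int : ∀ d, (∀ i, d ≠ D.rev (D.bd i)) → G d = G₀ d := by
    intro d hd
    simp only [G]
    rw [dif_neg fun ⟨i, hi⟩ => hd i hi]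
  have hδ_int : ∀ d, (∀ i, d ≠ D.rev (D.bd i)) → G d + G (D.rot⁻¹ (D.rev d)) = f₁ d := by
    intro d hd
    rw [hG_int d hd, hG_int]
    intro i hi
    rw [Equiv.Perm.inv_eq_iff_eq, D.rot_rev_bd] at hi
    exact hd (i + 1) (by rw [← hi, D.rev_rev])
  have hδ_ext : ∀ i, G (D.rev (D.bd i)) + G (D.rot⁻¹ (D.bd i)) = f₁ (D.bd i) := by
    intro i
    rw [show D.rot⁻¹ (D.bd i) = D.rev (D.bd (i - 1)) by
      rw [Equiv.Perm.inv_eq_iff_eq, rot_rev_bd_pred], hG_ext, hG_ext]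
    exact hpp i
  obtain ⟨u, hu, hu'⟩ := D.toCellDisc.exists_primitive G (by
    intro d
    by_cases h1 : ∃ i, d = D.bd i
    · obtain ⟨i, rfl⟩ := h1
      rw [hδ_ext, hδ_int _ (hbd_ne i)]
    · by_cases h2 : ∃ i, d = D.rev (D.bd i)
      · obtain ⟨i, rfl⟩ := h2
        have h3 := hδ_int _ (hbd_ne i)
        rw [D.rev_rev, hδ_ext, h3]
      · have h1' : ∀ i, d ≠ D.bd i := fun i hi => h1 ⟨i, hi⟩
        have h2' : ∀ i, d ≠ D.rev (D.bd i) := fun i hi => h2 ⟨i, hi⟩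
        have h4 := hδ_int (D.rev d) fun i hi => h1' i (D.rev.injective hi)
        rw [D.rev_rev] at h4
        rw [h4, hδ_int d h2']
        by_cases ha : D.arc d
        · rw [harc ⟨d, ha⟩, harc ⟨_, D.arc_rev _ ha⟩]
          exact hsym ⟨d, ha⟩
        · exact hnonarc d ha h1' h2')
  have hcob : ∀ d, (∀ i, d ≠ D.rev (D.bd i)) → f₁ d = u d + u (D.rev d) :=
    fun d hd => by rw [← hu', hδ_int d hd]
  refine ⟨(fun d => u d.1, u (D.bd 0) + u (D.bd D.m)), ⟨fun d e hs => ?_, fun d e h => ?_⟩,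
    funext fun d => ?_⟩
  · obtain ⟨n, hn⟩ := hs.exists_nat_pow_eq
    change u e.1 = u d.1
    rw [← hn]
    clear hn hs
    induction n with
    | zero => rfl
    | succ n ih => rw [pow_succ', Equiv.Perm.mul_apply, hu, ih]
  · refine antipodal_jump hu (fun i => ?_) h
    rw [← hcob _ (hbd_ne _), ← hcob _ (hbd_ne _), hbd]
  · change u d.1 + u (D.rev d.1) = f d
    rw [← hcob _ (hext d.1 d.2), harc]

/-! ## Orienting the curves -/

/-- The colour on the left of a dart as an element of `𝔽₂`. -/
def colourFn (c : D.Region → Bool) (d : D.ArcDart) : ZMod 2 := if c (D.region d.1) then 1 else 0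

theorem colourFn_revArc {c : D.Region → Bool} (hc : D.IsCheckerboardColouring c) (d : D.ArcDart) :
    colourFn c (revArc d) = colourFn c d + 1 := by
  rw [colourFn, colourFn, colour_revArc hc]
  cases c (D.region d.1) <;> simp [CharTwo.add_self_eq_zero]

theorem colourFn_of_antipodal (c : D.Region → Bool) {d e : D.ArcDart} (h : D.Antipodal d.1 e.1) :
    colourFn c e = colourFn c d := by
  rw [colourFn, colourFn, region_eq_of_antipodal h]

theorem colourFn_spliced {c : D.Region → Bool} (hc : D.IsCheckerboardColouring c) (σ : D.State)
    {d : D.ArcDart} (hs : D.rot.SameCycle d.1 (spliced σ d).1) :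
    colourFn c (spliced σ d) = colourFn c d + 1 := by
  have := colour_spliced_ne hc σ hs
  rw [colourFn, colourFn]
  revert this
  cases c (D.region d.1) <;> cases c (D.region (spliced σ d).1) <;> simp [CharTwo.add_self_eq_zero]

/-- Let `o` orient the spliced curves. Along them `colourFn c + o` is constant inside the disc and
flips exactly at the line at infinity, so `ε` times it cancels the jump of `u`. It is also constant
along arcs and does not disturb the coboundary. -/
theorem exists_curveFn {c : D.Region → Bool} (hc : D.IsCheckerboardColouring c) (σ : D.State)
    {u : D.ArcDart → ZMod 2} {ε : ZMod 2} (hu : (u, ε) ∈ D.jumpFns) :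
    ∃ b ∈ curveFns σ, ∀ d, b d + b (revArc d) = u d + u (revArc d) := by
  obtain ⟨o, ho1, ho2⟩ := exists_alternating (s := revArc) (t := spliced σ)
    revArc_revArc revArc_ne (spliced_spliced σ) (spliced_ne σ)
  obtain ⟨hu1, hu2⟩ := mem_jumpFns.1 hu
  refine ⟨fun d => u d + ε * (colourFn c d + o d), mem_curveFns.2 fun d => ?_, fun d => ?_⟩
  · rcases samePoint_spliced σ d with h | h
    · rw [hu1 _ _ h, ho2, colourFn_spliced hc σ h]
      have h2 : ∀ a b e g : ZMod 2, a + e * (b + 1 + (g + 1)) = a + e * (b + g) := by decide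
      exact h2 _ _ _ _
    · rw [hu2 _ _ h, ho2, colourFn_of_antipodal c h]
      have h2 : ∀ a b e g : ZMod 2, a + e + e * (b + (g + 1)) = a + e * (b + g) := by decide
      exact h2 _ _ _ _
  · beta_reduce
    rw [ho1, colourFn_revArc hc]
    have h2 : ∀ a a' b e g : ZMod 2,
        a + e * (b + g) + (a' + e * (b + 1 + (g + 1))) = a + a' := by decide
    exact h2 _ _ _ _ _

/-- The corrected functions of `exists_curveFn`, for `σ` and its dual, are primitives on the two
sides of the arcs. Any state will do here. -/
theorem le_cocycles {c : D.Region → Bool} (hc : D.IsCheckerboardColouring c) (σ : D.State) :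
    D.jumpFns.map D.jumpCoboundary ≤ cocycles revArc (sideDiff c σ) := by
  rintro _ ⟨⟨u, ε⟩, hu, rfl⟩
  obtain ⟨b, hb, hb'⟩ := exists_curveFn hc σ hu
  obtain ⟨w, hw, hw'⟩ := exists_curveFn hc (dualState σ) hu
  refine mem_cocycles.2 ⟨⟨(⟨b, hb⟩, ⟨w, hw⟩), funext fun d => ?_⟩, fun d => ?_⟩
  · rw [sideDiff_apply]
    simp only [hb', hw', ite_self]
    rfl
  · change u (revArc d) + u (revArc (revArc d)) = u d + u (revArc d)
    rw [revArc_revArc, add_comm]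

/-! ## The surface of the Tait graph -/

theorem ribbonGraph_boundaryComponent (σ : D.State) : Nat.card (ribbonGraph σ).BoundaryComponent =
    Nat.card (Classes fun d e : D.ArcDart => e = revArc d ∨ e = spliced (dualState σ) d) := by
  have : (fun x y : (ribbonGraph σ).End => y = (ribbonGraph σ).seg x ∨ y = (ribbonGraph σ).side x) =
      fun d e : D.ArcDart => e = revArc d ∨ e = spliced (dualState σ) d := by
    funext d e
    exact congrArg (fun z => e = revArc d ∨ e = z) (side_ribbonGraph σ d)
  unfold ArrowPresentation.BoundaryComponent
  rw [this]
  rfl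

theorem two_mul_card_edge (G : ArrowPresentation) :
    2 * Nat.card G.Edge = Nat.card {h : G.End // G.tail h} := by
  have h := card_eq_two_mul_classes (X := {h : G.End // G.tail h})
    (s := fun x => ⟨G.mate x.1, G.tail_mate _ x.2⟩) (fun x => Subtype.ext (G.mate_mate _ x.2))
    (fun x h => G.mate_ne _ x.2 (congrArg Subtype.val h))
  rw [h]
  have : (fun x y : {h : G.End // G.tail h} => y.1 = G.mate x.1) =
      fun x y => y = ⟨G.mate x.1, G.tail_mate _ x.2⟩ := by
    funext x y
    rw [Subtype.ext_iff]
  unfold ArrowPresentation.Edge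
  rw [this]

/-- Both inclusions identify the cocycles with the jump coboundaries; comparing their dimensions and
eliminating the number of points leaves χ. -/
theorem eulerChar_taitGraph (hconn : D.Connected) {c : D.Region → Bool}
    (hc : D.IsCheckerboardColouring c) :
    ((∃ t, D.IsPotential t) → (ribbonGraph (taitState c)).eulerChar = 2) ∧
    ((¬ ∃ t, D.IsPotential t) → (ribbonGraph (taitState c)).eulerChar = 1) := by
  have h1 := finrank_cocycles_sideDiff hconn hc (taitState c)
  rw [le_antisymm (cocycles_le hc) (le_cocycles hc _), ← ribbonGraph_boundaryComponent] at h1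
  change _ + 2 * (Nat.card (ribbonGraph (taitState c)).Vertex + _) = _ at h1
  have h2 := card_arcDart_eq (taitState c)
  have h3 := two_mul_card_edge (ribbonGraph (taitState c))
  change _ = Nat.card {d : D.ArcDart // Joins (taitState c) d.1} at h3
  obtain ⟨h4, h5⟩ := finrank_map_jumpCoboundary hconn
  unfold ArrowPresentation.eulerChar
  constructor
  · intro h
    have := h4 h
    omega
  · intro h
    have := h5 h
    omega

theorem connected_ribbonGraph (hconn : D.Connected) (σ : D.State) : (ribbonGraph σ).Connected := by
  refine ⟨hconn.1, fun d e => ((isChainConnected_spliced hconn σ).2 d e).mono fun x y h => ?_⟩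
  rw [side_ribbonGraph]
  exact h

/-- Along an arc, and at a point inside the disc, both the orientation and the colour flip, so their
sum is unchanged. At infinity only the orientation flips, since the colour on the left is preserved.
-/
theorem isPotential_of_alternating {c : D.Region → Bool} (hc : D.IsCheckerboardColouring c)
    {σ : D.State} {o : D.ArcDart → ZMod 2} (h1 : ∀ d, o (revArc d) = o d + 1)
    (h2 : ∀ d, o (spliced σ d) = o d + 1) (h3 : ∀ d, o (spliced (dualState σ) d) = o d + 1) :
    D.IsPotential fun d => o d + colourFn c d := by
  have hadd : ∀ a b : ZMod 2, a + 1 + (b + 1) = a + b := by decide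
  have hrot : ∀ {d e : D.ArcDart}, D.AtCrossing d.1 → e.1 = D.rot d.1 →
      o e + colourFn c e = o d + colourFn c d := by
    intro d e hd he
    have hs : ∀ τ : D.State, Joins τ d.1 → e = spliced τ d := fun τ hj =>
      Subtype.ext (he.trans (spliced_of_joins hj).symm)
    have hsc : D.rot.SameCycle d.1 e.1 := by rw [he]; exact sameCycle_rot_pow d.1 1
    by_cases hj : Joins σ d.1
    · have := hs σ hj
      subst this
      rw [h2, colourFn_spliced hc σ hsc, hadd]
    · have := hs _ ((joins_dualState σ hd).2 hj)
      subst this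
      rw [h3, colourFn_spliced hc _ hsc, hadd]
  refine ⟨mem_jumpFns.2 ⟨fun d e hs => ?_, fun d e h => ?_⟩, fun d => ?_⟩
  · by_cases hd : D.AtCrossing d.1
    · obtain ⟨n, hn⟩ := hs.exists_nat_pow_eq
      clear hs
      induction n generalizing e with
      | zero => rw [show e = d from Subtype.ext hn.symm]
      | succ n ih =>
        have hx : D.AtCrossing ((D.rot ^ n) d.1) := by
          clear ih hn
          induction n with
          | zero => exact hd
          | succ n ih => rw [pow_succ', Equiv.Perm.mul_apply]; exact ih.rot
        rw [pow_succ', Equiv.Perm.mul_apply] at hn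
        exact (hrot (d := ⟨_, hx.arc⟩) hx hn.symm).trans (ih ⟨_, hx.arc⟩ rfl)
    · rcases eq_or_eq_cont hd (Or.inl hs) with rfl | rfl
      · rfl
      · rw [← spliced_of_not_atCrossing (σ := σ) hd] at hs ⊢
        rw [h2, colourFn_spliced hc σ hs, hadd]
  · have hd : ¬ D.AtCrossing d.1 := by
      obtain ⟨i, hi, _⟩ := h
      exact not_atCrossing_of_atBd hi
    rcases eq_or_eq_cont hd (Or.inr h) with rfl | rfl
    · exact absurd h (not_antipodal_of_sameCycle (Equiv.Perm.SameCycle.refl _ _))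
    · rw [← spliced_of_not_atCrossing (σ := σ) hd] at h ⊢
      rw [h2, colourFn_of_antipodal c h, add_right_comm]
  · beta_reduce
    rw [h1, colourFn_revArc hc, hadd]

theorem alternating_of_isPotential {c : D.Region → Bool} (hc : D.IsCheckerboardColouring c)
    {t : D.ArcDart → ZMod 2} (ht : D.IsPotential t) (σ : D.State) (d : D.ArcDart) :
    t (spliced σ d) + colourFn c (spliced σ d) = t d + colourFn c d + 1 := by
  obtain ⟨h1, h2⟩ := mem_jumpFns.1 ht.1
  rcases samePoint_spliced σ d with h | h
  · rw [h1 _ _ h, colourFn_spliced hc σ h, add_assoc]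
  · rw [h2 _ _ h, colourFn_of_antipodal c h, add_right_comm]

/-- The half turn at a crossing consists of two quarter turns, one through a corner of each state.
-/
theorem opposite_eq_spliced {σ : D.State} {d : D.ArcDart} (h : Joins σ d.1) :
    opposite d = spliced (dualState σ) (spliced σ d) := by
  have e1 := spliced_of_joins h
  have hx : D.AtCrossing (spliced σ d).1 := by rw [e1]; exact h.1.rot
  have hj : Joins (dualState σ) (spliced σ d).1 := by
    rw [joins_dualState σ hx, e1, joins_rot σ _ h.1]
    exact not_not.2 h
  apply Subtype.ext
  rw [opposite, dif_pos h.1, spliced_of_joins hj, e1]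

theorem orientable_ribbonGraph_iff {c : D.Region → Bool} (hc : D.IsCheckerboardColouring c)
    (σ : D.State) : (ribbonGraph σ).Orientable ↔ ∃ t, D.IsPotential t := by
  classical
  constructor
  · rintro ⟨o, h1, h2, h3⟩
    -- Coherence over the ribbon edges means that the orientation also alternates along the boundary
    -- components.
    have h4 : ∀ d, o ((ribbonGraph σ).side d) = !(o d) := by
      intro d
      unfold ArrowPresentation.side
      split_ifs with h5 h6
      · rw [h2, h3 d h5]
      · rw [h3 _ h6, h2]
      · exact h2 d
    have hflip : ∀ {d e : D.ArcDart}, o e = !(o d) →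
        (if o e then (1 : ZMod 2) else 0) = (if o d then 1 else 0) + 1 := by
      intro d e h
      rw [h]
      cases o d <;> simp [CharTwo.add_self_eq_zero]
    refine ⟨_, isPotential_of_alternating hc (σ := σ) (o := fun d => if o d then 1 else 0)
      (fun d => hflip (h1 d)) (fun d => hflip (h2 d)) fun d => hflip ?_⟩
    rw [← side_ribbonGraph]
    exact h4 d
  · rintro ⟨t, ht⟩
    let o : D.ArcDart → ZMod 2 := fun d => t d + colourFn c d
    have hflip : ∀ {d e : D.ArcDart}, o e = o d + 1 → decide (o e = 1) = !decide (o d = 1) := by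
      intro d e h
      have key : ∀ a : ZMod 2, decide (a + 1 = 1) = !decide (a = 1) := by decide
      rw [h, key]
    have hrev : ∀ d, o (revArc d) = o d + 1 := by
      intro d
      simp only [o]
      rw [ht.2, colourFn_revArc hc, add_assoc]
    have hmate : ∀ d : D.ArcDart, Joins σ d.1 → decide (o (opposite d) = 1) = decide (o d = 1) := by
      intro d hd
      rw [opposite_eq_spliced hd, hflip (alternating_of_isPotential hc ht (dualState σ) _),
        hflip (alternating_of_isPotential hc ht σ d), Bool.not_not]
    exact ⟨fun d => decide (o d = 1), fun d => hflip (hrev d),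
      fun d => hflip (alternating_of_isPotential hc ht σ d), hmate⟩

/-! ## Closed curves in the net -/

theorem path_trans {d e f : D.ArcDart} {p q : ZMod 2} (h1 : D.Path d e p) (h2 : D.Path e f q) :
    D.Path d f (p + q) := by
  induction h2 with
  | refl => simpa using h1
  | edge e f q _ h ih => exact Path.edge _ _ _ _ ih h
  | turn e f q _ h ih => exact Path.turn _ _ _ _ ih h
  | infinity e f q _ h ih =>
    rw [← add_assoc]
    exact Path.infinity _ _ _ _ ih h

theorem path_symm {d e : D.ArcDart} {p : ZMod 2} (h : D.Path d e p) : D.Path e d p := by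
  induction h with
  | refl => exact Path.refl d
  | edge e f q _ h ih =>
    have h1 := Path.edge f f e 0 (Path.refl f) (by rw [h, D.rev_rev])
    simpa using path_trans h1 ih
  | turn e f q _ h ih =>
    simpa using path_trans (Path.turn f f e 0 (Path.refl f) h.symm) ih
  | infinity e f q _ h ih =>
    have := path_trans (Path.infinity f f e 0 (Path.refl f) (antipodal_symm h)) ih
    rwa [zero_add, add_comm] at this

theorem exists_path (hconn : D.Connected) (d e : D.ArcDart) : ∃ p, D.Path d e p := by
  have h := hconn.2 d e
  induction h with
  | rel x y h =>
    rcases h with h | h | h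
    · exact ⟨_, Path.edge _ _ _ _ (Path.refl x) h⟩
    · exact ⟨_, Path.turn _ _ _ _ (Path.refl x) h⟩
    · exact ⟨_, Path.infinity _ _ _ _ (Path.refl x) h⟩
  | refl x => exact ⟨_, Path.refl x⟩
  | symm x y _ ih => exact ih.imp fun _ => path_symm
  | trans x y z _ _ ih1 ih2 =>
    obtain ⟨p, hp⟩ := ih1
    obtain ⟨q, hq⟩ := ih2
    exact ⟨_, path_trans hp hq⟩

theorem IsPotential.path {t : D.ArcDart → ZMod 2} (ht : D.IsPotential t) {d e : D.ArcDart}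
    {p : ZMod 2} (h : D.Path d e p) : t e = t d + p := by
  obtain ⟨h1, h2⟩ := mem_jumpFns.1 ht.1
  induction h with
  | refl => rw [add_zero]
  | edge e f q _ h ih => rw [show f = revArc e from Subtype.ext h, ht.2, ih]
  | turn e f q _ h ih => rw [h1 _ _ h, ih]
  | infinity e f q _ h ih => rw [h2 _ _ h, ih, add_assoc]

/-- The potential at a dart is the crossing parity of any path to it from a base point; two paths of
different parity would close up to a nontrivial loop. -/
theorem totallyNullHomologous_iff (hconn : D.Connected) :
    D.TotallyNullHomologous ↔ ∃ t, D.IsPotential t := by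
  constructor
  · intro hn
    obtain ⟨d₀⟩ := hconn.1
    choose t ht using exists_path hconn d₀
    have huniq : ∀ {e : D.ArcDart} {p : ZMod 2}, D.Path d₀ e p → t e = p := by
      intro e p h
      by_contra hne
      have h1 : ∀ a b : ZMod 2, ¬ a = b → a + b = 1 := by decide
      have h2 := path_trans (ht e) (path_symm h)
      rw [h1 _ _ hne] at h2
      exact hn d₀ h2
    exact ⟨t, mem_jumpFns.2 ⟨fun d e h => huniq (Path.turn _ _ _ _ (ht d) h),
      fun d e h => huniq (Path.infinity _ _ _ _ (ht d) h)⟩,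
      fun d => huniq (Path.edge _ _ _ _ (ht d) rfl)⟩
  · rintro ⟨t, ht⟩ d h
    have h1 := ht.path h
    have h2 : ∀ a : ZMod 2, a ≠ a + 1 := by decide
    exact h2 _ h1

/-! ### Components of the link -/

theorem thru_injective : Function.Injective D.thru := by
  have h : ∀ d : D.ArcDart, D.thru (D.thru d) = d := by
    intro d
    by_cases hd : D.AtCrossing d.1
    · have e1 : D.thru d = ⟨D.rot (D.rot d.1), hd.rot.rot.arc⟩ := by rw [thru, dif_pos hd]
      rw [e1, thru, dif_pos hd.rot.rot]
      exact Subtype.ext hd.2.2.1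
    · have e1 : D.thru d = D.cont d := by rw [thru, dif_neg hd]
      rw [e1, thru, dif_neg (not_atCrossing_of_samePoint hd (cont_spec d hd).2), cont_cont d hd]
  exact Function.LeftInverse.injective h

theorem step_injective : Function.Injective D.step := by
  intro d e h
  have := congrArg Subtype.val (thru_injective h)
  exact Subtype.ext (D.rev.injective this)

-- A step ends at a boundary point exactly when it has passed through the line at infinity, because
-- a boundary point carries only one end of an arc.
open Classical in
theorem IsPotential.step {t : D.ArcDart → ZMod 2} (ht : D.IsPotential t) (d : D.ArcDart) :
    t (D.step d) = t d + if ∃ i, D.AtBd i (D.step d).1 then 1 else 0 := by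
  obtain ⟨h1, h2⟩ := mem_jumpFns.1 ht.1
  rw [← ht.2 d]
  change t (D.thru (revArc d)) = t (revArc d) + if ∃ i, D.AtBd i (D.thru (revArc d)).1 then 1 else 0
  generalize revArc d = e
  by_cases he : D.AtCrossing e.1
  · have e1 : D.thru e = ⟨D.rot (D.rot e.1), he.rot.rot.arc⟩ := by rw [thru, dif_pos he]
    rw [e1, if_neg fun ⟨i, hi⟩ => not_atCrossing_of_atBd hi he.rot.rot, add_zero]
    exact h1 _ _ (sameCycle_rot_pow e.1 2)
  · have e1 : D.thru e = D.cont e := by rw [thru, dif_neg he]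
    obtain ⟨hne, hs | hs⟩ := cont_spec e he
    · rw [e1, if_neg, h1 _ _ hs, add_zero]
      rintro ⟨i, hi⟩
      exact hne (Subtype.ext (D.end_unique i _ _ (D.cont e).2 e.2 hi (hi.trans hs.symm)))
    · obtain ⟨i, _, hi⟩ := id hs
      rw [e1, if_pos ⟨_, hi⟩, h2 _ _ hs]

/-- Going once around a component the potential returns to its value, so the number of its unit
jumps is even. -/
theorem IsPotential.nullHomologous {t : D.ArcDart → ZMod 2} (ht : D.IsPotential t) :
    D.NullHomologous := by
  classical
  intro d
  have : Fintype D.ArcDart := Fintype.ofFinite _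
  unfold ComponentNull
  let O : Finset D.ArcDart := Finset.univ.filter fun e => ∃ n : ℕ, D.step^[n] d = e
  -- `step` is injective and maps the finite forward orbit into itself, so it permutes it and the
  -- sums of `t` before and after a step cancel.
  have himg : O.image D.step = O := by
    refine Finset.eq_of_subset_of_card_le (fun e he => ?_) ?_
    · obtain ⟨f, hf, rfl⟩ := Finset.mem_image.1 he
      obtain ⟨n, rfl⟩ := (Finset.mem_filter.1 hf).2
      exact Finset.mem_filter.2 ⟨Finset.mem_univ _, n + 1, Function.iterate_succ_apply' _ _ _⟩
    · rw [Finset.card_image_of_injective _ step_injective]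
  have hsum : ∀ g : D.ArcDart → ZMod 2, ∑ e ∈ O, g (D.step e) = ∑ e ∈ O, g e := by
    intro g
    conv_rhs => rw [← himg]
    rw [Finset.sum_image fun _ _ _ _ h => step_injective h]
  have h1 := hsum t
  rw [Finset.sum_congr rfl fun e _ => ht.step e, Finset.sum_add_distrib,
    hsum fun e => if ∃ i, D.AtBd i e.1 then 1 else 0, add_eq_left, Finset.sum_boole,
    Finset.filter_filter] at h1
  rw [Nat.card_eq_fintype_card, Fintype.card_subtype]
  exact (ZMod.natCast_eq_zero_iff_even).1 h1

end LinkDiagram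

/-! ### The type of the Tait graphs -/

theorem proposition3p2 (D : LinkDiagram) (hconn : D.Connected)
    (hcol : D.CheckerboardColourable) :
    ∀ G : ArrowPresentation, D.IsTaitGraph G →
      (G.IsPlane ∨ G.IsRP2) ∧
      (D.TotallyNullHomologous → G.IsPlane) ∧
      (¬ D.TotallyNullHomologous → G.IsRP2) ∧
      (¬ D.NullHomologous → G.IsRP2) := by
  rintro _ ⟨c, hc, rfl⟩
  have hG := LinkDiagram.connected_ribbonGraph hconn (LinkDiagram.taitState c)
  have ho := LinkDiagram.orientable_ribbonGraph_iff hc (LinkDiagram.taitState c)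
  obtain ⟨h2, h1⟩ := LinkDiagram.eulerChar_taitGraph hconn hc
  have htn := LinkDiagram.totallyNullHomologous_iff hconn
  have hplane : D.TotallyNullHomologous →
      (LinkDiagram.ribbonGraph (LinkDiagram.taitState c)).IsPlane := fun h =>
    ⟨hG, ho.2 (htn.1 h), Or.inl ⟨ho.2 (htn.1 h), by rw [h2 (htn.1 h)]; norm_num⟩⟩
  have hrp2 : ¬ D.TotallyNullHomologous →
      (LinkDiagram.ribbonGraph (LinkDiagram.taitState c)).IsRP2 := fun h =>
    have h' := fun ht => h (htn.2 ht)
    ⟨hG, fun hor => h' (ho.1 hor), Or.inr ⟨fun hor => h' (ho.1 hor), by rw [h1 h']; norm_num⟩⟩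
  refine ⟨?_, hplane, hrp2, fun h => hrp2 fun hn => h ?_⟩
  · by_cases h : D.TotallyNullHomologous
    · exact Or.inl (hplane h)
    · exact Or.inr (hrp2 h)
  · obtain ⟨t, ht⟩ := htn.1 hn
    exact ht.nullHomologous
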